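/- Let $n\in\{2,3\}$ and let $\Omega,\Omega_1,\Omega_2\subset\mathbb{R}^n$ be bounded Lipschitz domains (bounded open sets which near every boundary point are, in suitable orthonormal coordinates, the strict epigraph of a Lipschitz function; connectedness is not needed), with $\Omega_1\cap\Omega_2=\emptyset$ and $\overline{\Omega}=\overline{\Omega_1}\cup\overline{\Omega_2}$. Let $\mathbf{w}\colon[0,\infty)\times\mathbb{R}^n\to\mathbb{R}^n$ be a velocity field that generates a transformation $\Phi\colon[0,\infty)\times\mathbb{R}^n\to\mathbb{R}^n$, i.e. $\frac{\mathrm d}{\mathrm dt}\Phi_t(x)=\mathbf{w}(t,\Phi_t(x))$ for $t>0$ and $\Phi_0(x)=x$ for all $x\in\mathbb{R}^n$. Assume that (i) $\Phi\in C^1([0,\infty)\times\mathbb{R}^n,\mathbb{R}^n)$ and, for every $r>0$, $\sup_{t>0}\|\Phi_t\|_{C^1(\overline{B_r},\mathbb{R}^n)}<\infty$, where $B_r=\{|x|<r\}$; (ii) every $\Phi_t$ is a bijection of $\mathbb{R}^n$, and $\Phi_-\colon(t,x)\mapsto\Phi_{-t}(x):=(\Phi_t)^{-1}(x)$ satisfies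 the same regularity and bounds as $\Phi$. For $t\ge 0$ put $\Omega(t)=\Phi_t(\Omega)$, $\Omega_i(t)=\Phi_t(\Omega_i)$, $\Gamma(t)=\partial\Omega_1(t)\cap\partial\Omega_2(t)$. Let $S=\{S(t)\}_{t\ge0}$ be any of the families $\partial\Omega$, $\partial\Omega_1$, $\partial\Omega_2$, $\Gamma$. Let $\mathrm{d}s_t$ be the surface measure on $S(t)$ (the $(n-1)$-dimensional Hausdorff measure, normalized to agree with Lebesgue measure on hyperplanes), let $L^2(S(t))$ be the corresponding real $L^2$-space, let $H^{1/2}(S(t))$ be the space of all $u\in L^2(S(t))$ for which the norm $$\|u\|_{H^{1/2}(S(t))}=\Big(\int_{S(t)}\int_{S(t)}\frac{|u(x)-u(y)|^2}{|x-y|^{n}}\,\mathrm{d}s_t\,\mathrm{d}s_t+\|u\|_{L^2(S(t))}^2\Big)^{1/2}$$ is finite, and, for $i=1,2$, let $$\Lambda_i(t)=\{u\in L^2(\Gamma(t)): e_{\partial\Omega_i(t)}u\in H^{1/2}(\partial\Omega_i(t))\},\qquad \|u\|_{\Lambda_i(t)}=\|e_{\partial\Omega_i(t)}u\|_{H^{1/2}(\partial\Omega_i(t))},$$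 be the Lions--Magenes spaces, where $e_{\partial\Omega_i(t)}$ denotes the extension by zero from $\Gamma(t)$ to $\partial\Omega_i(t)$. For functions $u$ on $S(0)$ let $\psi_tu=u\circ\Phi_{-t}|_{S(t)}$, and for functions $v$ on $S(t)$ let $\psi_{-t}v=v\circ\Phi_t|_{S(0)}$. Then $(L^2(S),\psi)$ and $(H^{1/2}(S),\psi)$, for each of the four families $S$, and $(\Lambda_i,\psi)$, for $i=1,2$, are compatible pairs. Here $(X,\psi)$ is called a compatible pair if all $X(t)$, $t\ge0$, are real separable Hilbert spaces, each $\psi_t\colon X(0)\to X(t)$ is a well-defined linear bijection with inverse $\psi_{-t}$, and: (i) $\psi_0$ is the identity; (ii) there is a constant $C$, independent of $t\ge0$, with $\|\psi_tu\|_{X(t)}\le C\|u\|_{X(0)}$ for all $u\in X(0)$ and $\|\psi_{-t}v\|_{X(0)}\le C\|v\|_{X(t)}$ for all $v\in X(t)$; (iii) for every $u\in X(0)$ the map $t\mapsto\|\psi_tu\|_{X(t)}$ is measurable. -/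

import Mathlib

open MeasureTheory Set
open scoped NNReal ENNReal

noncomputable section

/-! ### Compatible pairs -/

/-- A family `X t`, `t ∈ [0, ∞)`, of real inner product spaces with linear bijections
`φ t : X 0 → X t` is a *compatible pair*: every `X t` is a separable Hilbert space, `φ 0` is the
identity, `φ t` and its inverse are bounded uniformly in `t`, and `t ↦ ‖φ t u‖` is measurable for
every `u`. -/
structure IsCompatiblePair (X : ℝ≥0 → Type) [∀ t, NormedAddCommGroup (X t)]
    [∀ t, InnerProductSpace ℝ (X t)] (φ : ∀ t, X 0 ≃ₗ[ℝ] X t) : Prop where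
  complete : ∀ t, CompleteSpace (X t)
  separable : ∀ t, TopologicalSpace.SeparableSpace (X t)
  map_zero : ∀ u : X 0, φ 0 u = u
  bounded : ∃ C : ℝ, ∀ t : ℝ≥0,
    (∀ u : X 0, ‖φ t u‖ ≤ C * ‖u‖) ∧ (∀ v : X t, ‖(φ t).symm v‖ ≤ C * ‖v‖)
  measurable_norm : ∀ u : X 0, Measurable fun t : ℝ≥0 => ‖φ t u‖

/-! ### The geometry and the flow -/

/-- A bounded open set `Ω ⊆ ℝⁿ` that near each of its boundary points `x` is, in a suitable
orthonormal coordinate system with last axis `e`, the strict epigraph `{z + s e : σ z < s}` of a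
Lipschitz function `σ` of the coordinates `z ⟂ e`. (Connectedness is not asked for, so that unions
of finitely many separated subdomains are included.) -/
structure IsBoundedLipschitzDomain {n : ℕ} (Ω : Set (EuclideanSpace ℝ (Fin n))) : Prop where
  isOpen : IsOpen Ω
  isBounded : Bornology.IsBounded Ω
  lipschitz_boundary : ∀ x ∈ frontier Ω,
    ∃ e : EuclideanSpace ℝ (Fin n), ‖e‖ = 1 ∧
    ∃ (K : ℝ≥0) (σ : (Submodule.span ℝ {e})ᗮ → ℝ), LipschitzWith K σ ∧
    ∃ r : ℝ, 0 < r ∧ ∀ (z : (Submodule.span ℝ {e})ᗮ) (s : ℝ),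
      (z : EuclideanSpace ℝ (Fin n)) + s • e ∈ Metric.ball x r →
        ((z : EuclideanSpace ℝ (Fin n)) + s • e ∈ Ω ↔ σ z < s)

/-- `F` is of class `C¹` on `[0, ∞) × ℝⁿ`, and for every radius `r` the `C¹`-norm of `F t` on the
closed ball of radius `r` is bounded uniformly in `t > 0`. -/
structure IsUniformlyC1 {n : ℕ}
    (F : ℝ → EuclideanSpace ℝ (Fin n) → EuclideanSpace ℝ (Fin n)) : Prop where
  contDiffOn : ContDiffOn ℝ 1 (fun p : ℝ × EuclideanSpace ℝ (Fin n) => F p.1 p.2)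
    (Ici 0 ×ˢ univ)
  bound : ∀ r : ℝ, 0 < r → ∃ C : ℝ, ∀ t : ℝ, 0 < t → ∀ x ∈ Metric.closedBall 0 r,
    ‖F t x‖ ≤ C ∧ ‖fderiv ℝ (F t) x‖ ≤ C

/-- The velocity field `w` generates the transformation `Φ`, the maps `Φ t` are invertible with
inverses `Φinv t`, and both `Φ` and `Φinv` are of class `C¹` with locally uniform bounds. -/
structure IsC1Flow {n : ℕ}
    (w Φ Φinv : ℝ → EuclideanSpace ℝ (Fin n) → EuclideanSpace ℝ (Fin n)) : Prop where
  initial : ∀ x, Φ 0 x = x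
  ode : ∀ t : ℝ, 0 < t → ∀ x, HasDerivAt (fun s => Φ s x) (w t (Φ t x)) t
  left_inv : ∀ t : ℝ, 0 ≤ t → Function.LeftInverse (Φinv t) (Φ t)
  right_inv : ∀ t : ℝ, 0 ≤ t → Function.RightInverse (Φinv t) (Φ t)
  smooth : IsUniformlyC1 Φ
  smooth_inv : IsUniformlyC1 Φinv

/-- The interface `∂Ω₁ ∩ ∂Ω₂` between two sets; the indices are `0, 1 : Fin 2`. -/
def interface {n : ℕ} (Ω : Fin 2 → Set (EuclideanSpace ℝ (Fin n))) :
    Set (EuclideanSpace ℝ (Fin n)) :=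
  frontier (Ω 0) ∩ frontier (Ω 1)

theorem interface_subset {n : ℕ} (Ω : Fin 2 → Set (EuclideanSpace ℝ (Fin n))) (i : Fin 2) :
    interface Ω ⊆ frontier (Ω i) := by
  fin_cases i
  · exact inter_subset_left
  · exact inter_subset_right

theorem measurableSet_interface {n : ℕ} (Ω : Fin 2 → Set (EuclideanSpace ℝ (Fin n))) :
    MeasurableSet (interface Ω) :=
  (isClosed_frontier.inter isClosed_frontier).measurableSet

/-! ### The function spaces -/

/-- The surface measure on `S ⊆ ℝⁿ`: the restriction to `S` of the `(n-1)`-dimensional Hausdorff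
measure, normalized so that it is Lebesgue measure on hyperplanes. -/
def surfaceMeasure {n : ℕ} (S : Set (EuclideanSpace ℝ (Fin n))) :
    Measure (EuclideanSpace ℝ (Fin n)) :=
  (Measure.euclideanHausdorffMeasure (n - 1)).restrict S

/-- The space `L²(S)` of real functions, with respect to the surface measure. -/
abbrev L2Surface {n : ℕ} (S : Set (EuclideanSpace ℝ (Fin n))) : Type :=
  Lp ℝ 2 (surfaceMeasure S)

/-- The difference quotient `(f x - f y) / |x - y|^(n/2)`, whose square is the integrand
`|f x - f y|² / |x - y|ⁿ` of the `H^{1/2}` seminorm. -/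
def diffQuot {n : ℕ} (f : EuclideanSpace ℝ (Fin n) → ℝ)
    (p : EuclideanSpace ℝ (Fin n) × EuclideanSpace ℝ (Fin n)) : ℝ :=
  (f p.1 - f p.2) / dist p.1 p.2 ^ ((n : ℝ) / 2)

/-- `(surfaceMeasure S)²`, the measure `ds ds` on `S × S`. -/
abbrev surfaceMeasureSq {n : ℕ} (S : Set (EuclideanSpace ℝ (Fin n))) :
    Measure (EuclideanSpace ℝ (Fin n) × EuclideanSpace ℝ (Fin n)) :=
  (surfaceMeasure S).prod (surfaceMeasure S)

theorem diffQuot_congr {n : ℕ} {S : Set (EuclideanSpace ℝ (Fin n))}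
    {f g : EuclideanSpace ℝ (Fin n) → ℝ} (h : f =ᵐ[surfaceMeasure S] g) :
    diffQuot f =ᵐ[surfaceMeasureSq S] diffQuot g := by
  filter_upwards [Measure.quasiMeasurePreserving_fst.ae_eq_comp h,
    Measure.quasiMeasurePreserving_snd.ae_eq_comp h] with p h1 h2
  simp only [Function.comp_apply] at h1 h2
  simp only [diffQuot, h1, h2]

theorem diffQuot_add {n : ℕ} {S : Set (EuclideanSpace ℝ (Fin n))} (u v : L2Surface S) :
    diffQuot (u + v : L2Surface S) =ᵐ[surfaceMeasureSq S] diffQuot u + diffQuot v := by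
  refine (diffQuot_congr (Lp.coeFn_add u v)).trans (Filter.Eventually.of_forall fun p => ?_)
  simp only [diffQuot, Pi.add_apply]
  ring

theorem diffQuot_smul {n : ℕ} {S : Set (EuclideanSpace ℝ (Fin n))} (c : ℝ) (u : L2Surface S) :
    diffQuot (c • u : L2Surface S) =ᵐ[surfaceMeasureSq S] c • diffQuot u := by
  refine (diffQuot_congr (Lp.coeFn_smul c u)).trans (Filter.Eventually.of_forall fun p => ?_)
  simp only [diffQuot, Pi.smul_apply, smul_eq_mul]
  ring

/-- The subspace of those `u ∈ L²(S)` whose `H^{1/2}` seminorm is finite, that is, with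
`∬ |u x - u y|² / |x - y|ⁿ ds ds < ∞`. -/
def hHalfSubmodule {n : ℕ} (S : Set (EuclideanSpace ℝ (Fin n))) :
    Submodule ℝ (L2Surface S) where
  carrier := {u | MemLp (diffQuot u) 2 (surfaceMeasureSq S)}
  add_mem' {u v} hu hv := (memLp_congr_ae (diffQuot_add u v)).2 (hu.add hv)
  zero_mem' := by
    have h := diffQuot_smul (S := S) 0 0
    simp only [zero_smul] at h
    exact (memLp_congr_ae h).2 MemLp.zero
  smul_mem' c u hu := (memLp_congr_ae (diffQuot_smul c u)).2 (hu.const_smul c)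

/-- The space `H^{1/2}(S)`. -/
def HHalf {n : ℕ} (S : Set (EuclideanSpace ℝ (Fin n))) : Type := hHalfSubmodule S

namespace HHalf

variable {n : ℕ} {S : Set (EuclideanSpace ℝ (Fin n))}

instance : AddCommGroup (HHalf S) := inferInstanceAs (AddCommGroup (hHalfSubmodule S))

instance : Module ℝ (HHalf S) := inferInstanceAs (Module ℝ (hHalfSubmodule S))

/-- The inclusion of `H^{1/2}(S)` into `L²(S)`. -/
def toL2 : HHalf S →ₗ[ℝ] L2Surface S := (hHalfSubmodule S).subtype

theorem toL2_injective : Function.Injective (toL2 (S := S)) := Subtype.val_injective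

theorem mem_hHalf (u : L2Surface S) :
    u ∈ hHalfSubmodule S ↔ MemLp (diffQuot u) 2 (surfaceMeasureSq S) := Iff.rfl

theorem toL2_mem (u : HHalf S) : toL2 u ∈ hHalfSubmodule S := Subtype.property u

/-- An element of `L²(S)` with finite `H^{1/2}` seminorm, as an element of `H^{1/2}(S)`. -/
def mk (u : L2Surface S) (hu : u ∈ hHalfSubmodule S) : HHalf S := ⟨u, hu⟩

theorem toL2_mk (u : L2Surface S) (hu : u ∈ hHalfSubmodule S) : toL2 (mk u hu) = u := rfl

theorem memLp_diffQuot (u : HHalf S) : MemLp (diffQuot (toL2 u)) 2 (surfaceMeasureSq S) :=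
  (mem_hHalf _).1 (toL2_mem u)

/-- The difference quotient of `u ∈ H^{1/2}(S)`, as an element of `L²(S × S)`. -/
def quot : HHalf S →ₗ[ℝ] Lp ℝ 2 (surfaceMeasureSq S) where
  toFun u := MemLp.toLp (diffQuot (toL2 u)) (memLp_diffQuot u)
  map_add' u v := by
    rw [← MemLp.toLp_add]
    exact (MemLp.toLp_eq_toLp_iff _ _).2
      (by rw [map_add]; exact diffQuot_add (toL2 u) (toL2 v))
  map_smul' c u := by
    rw [RingHom.id_apply, ← MemLp.toLp_const_smul]
    exact (MemLp.toLp_eq_toLp_iff _ _).2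
      (by rw [map_smul]; exact diffQuot_smul c (toL2 u))

/-- `u ↦ (u, diffQuot u)`, with values in the Hilbert sum `L²(S) ⊕ L²(S × S)`. -/
def graphMap : HHalf S →ₗ[ℝ] WithLp 2 (L2Surface S × Lp ℝ 2 (surfaceMeasureSq S)) :=
  (WithLp.linearEquiv 2 ℝ (L2Surface S × Lp ℝ 2 (surfaceMeasureSq S))).symm.toLinearMap ∘ₗ
    toL2.prod quot

theorem graphMap_injective : Function.Injective (graphMap (S := S)) := by
  intro u v h
  have h1 := congrArg (fun p => (WithLp.ofLp p).1) h
  exact toL2_injective h1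

/-- The norm of `H^{1/2}(S)`; see `norm_sq_eq` for the formula. -/
instance : NormedAddCommGroup (HHalf S) :=
  NormedAddCommGroup.induced (HHalf S) _ graphMap graphMap_injective

instance : InnerProductSpace ℝ (HHalf S) := InnerProductSpace.induced graphMap

theorem norm_sq_eq (u : HHalf S) :
    ‖u‖ ^ 2 = (∫ p, |toL2 u p.1 - toL2 u p.2| ^ 2 / dist p.1 p.2 ^ n ∂surfaceMeasureSq S) +
      ‖toL2 u‖ ^ 2 := by
  have h1 : ‖u‖ ^ 2 = ‖toL2 u‖ ^ 2 + ‖quot u‖ ^ 2 := by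
    change ‖graphMap u‖ ^ 2 = _
    rw [WithLp.prod_norm_sq_eq_of_L2]
    rfl
  rw [h1, add_comm, ← real_inner_self_eq_norm_sq (quot u), L2.inner_def]
  congr 1
  refine integral_congr_ae ?_
  filter_upwards [MemLp.coeFn_toLp (memLp_diffQuot u)] with p hp
  have hp' : quot u p = diffQuot (toL2 u) p := hp
  rw [hp', real_inner_self_eq_norm_sq, diffQuot, Real.norm_eq_abs, abs_div, div_pow,
    abs_of_nonneg (Real.rpow_nonneg dist_nonneg _), ← Real.rpow_mul_natCast dist_nonneg]
  norm_num

end HHalf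

theorem memLp_indicator_surface {n : ℕ} {S : Set (EuclideanSpace ℝ (Fin n))}
    (T : Set (EuclideanSpace ℝ (Fin n))) (hS : MeasurableSet S) (u : L2Surface S) :
    MemLp (S.indicator u) 2 (surfaceMeasure T) := by
  rw [memLp_indicator_iff_restrict hS]
  refine (Lp.memLp u).mono_measure ?_
  rw [surfaceMeasure, surfaceMeasure, Measure.restrict_restrict hS]
  exact Measure.restrict_mono_set _ inter_subset_left

theorem indicator_congr_surface {n : ℕ} {S : Set (EuclideanSpace ℝ (Fin n))}
    (T : Set (EuclideanSpace ℝ (Fin n))) (hS : MeasurableSet S)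
    {f g : EuclideanSpace ℝ (Fin n) → ℝ} (h : f =ᵐ[surfaceMeasure S] g) :
    S.indicator f =ᵐ[surfaceMeasure T] S.indicator g := by
  have h' : ∀ᵐ x ∂Measure.euclideanHausdorffMeasure (n - 1), x ∈ S → f x = g x :=
    (ae_restrict_iff' hS).1 h
  filter_upwards [ae_restrict_of_ae (s := T) h'] with x hx
  by_cases hxS : x ∈ S
  · simp [hxS, hx hxS]
  · simp [hxS]

/-- Extension by zero `L²(S) → L²(T)`, for a measurable set `S`. -/
def extendByZero {n : ℕ} {S : Set (EuclideanSpace ℝ (Fin n))}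
    (T : Set (EuclideanSpace ℝ (Fin n))) (hS : MeasurableSet S) :
    L2Surface S →ₗ[ℝ] L2Surface T where
  toFun u := MemLp.toLp (S.indicator u) (memLp_indicator_surface T hS u)
  map_add' u v := by
    rw [← MemLp.toLp_add, MemLp.toLp_eq_toLp_iff]
    refine (indicator_congr_surface T hS (Lp.coeFn_add u v)).trans ?_
    rw [indicator_add']
  map_smul' c u := by
    rw [RingHom.id_apply, ← MemLp.toLp_const_smul, MemLp.toLp_eq_toLp_iff]
    refine (indicator_congr_surface T hS (Lp.coeFn_smul c u)).trans ?_
    exact Filter.Eventually.of_forall fun x => by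
      by_cases hx : x ∈ S <;> simp [hx]

theorem extendByZero_injective {n : ℕ} {S T : Set (EuclideanSpace ℝ (Fin n))}
    (hS : MeasurableSet S) (hST : S ⊆ T) :
    Function.Injective (extendByZero (S := S) T hS) := by
  intro u v h
  have h1 : S.indicator u =ᵐ[surfaceMeasure T] S.indicator v :=
    (MemLp.toLp_eq_toLp_iff (memLp_indicator_surface T hS u)
      (memLp_indicator_surface T hS v)).1 h
  have h2 : S.indicator u =ᵐ[surfaceMeasure S] S.indicator v :=
    ae_mono (Measure.restrict_mono_set _ hST) h1
  refine Lp.ext ?_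
  filter_upwards [h2, ae_restrict_mem hS] with x hx hxS
  simpa [hxS] using hx

/-- The subspace of those `u ∈ L²(Γ)`, `Γ = ∂Ω₁ ∩ ∂Ω₂`, with `e u ∈ H^{1/2}(∂Ωᵢ)`, where `e` is the
extension by zero from `Γ` to `∂Ωᵢ`. -/
def lionsMagenesSubmodule {n : ℕ} (Ω : Fin 2 → Set (EuclideanSpace ℝ (Fin n))) (i : Fin 2) :
    Submodule ℝ (L2Surface (interface Ω)) :=
  (hHalfSubmodule (frontier (Ω i))).comap
    (extendByZero (frontier (Ω i)) (measurableSet_interface Ω))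

/-- The Lions–Magenes space `Λ`. -/
def LionsMagenes {n : ℕ} (Ω : Fin 2 → Set (EuclideanSpace ℝ (Fin n))) (i : Fin 2) : Type :=
  lionsMagenesSubmodule Ω i

namespace LionsMagenes

variable {n : ℕ} {Ω : Fin 2 → Set (EuclideanSpace ℝ (Fin n))} {i : Fin 2}

instance : AddCommGroup (LionsMagenes Ω i) :=
  inferInstanceAs (AddCommGroup (lionsMagenesSubmodule Ω i))

instance : Module ℝ (LionsMagenes Ω i) :=
  inferInstanceAs (Module ℝ (lionsMagenesSubmodule Ω i))

/-- The inclusion of `Λ` into `L²(Γ)`. -/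
def toL2 : LionsMagenes Ω i →ₗ[ℝ] L2Surface (interface Ω) := (lionsMagenesSubmodule Ω i).subtype

theorem toL2_injective : Function.Injective (toL2 (Ω := Ω) (i := i)) := Subtype.val_injective

theorem toL2_mem (u : LionsMagenes Ω i) : toL2 u ∈ lionsMagenesSubmodule Ω i :=
  Subtype.property u

theorem extendByZero_mem (u : LionsMagenes Ω i) :
    extendByZero (frontier (Ω i)) (measurableSet_interface Ω) (toL2 u) ∈
      hHalfSubmodule (frontier (Ω i)) :=
  Submodule.mem_comap.1 (toL2_mem u)

/-- The extension by zero, as a map from `Λ` to `H^{1/2}(∂Ωᵢ)`. -/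
def extend : LionsMagenes Ω i →ₗ[ℝ] HHalf (frontier (Ω i)) where
  toFun u := HHalf.mk (extendByZero (frontier (Ω i)) (measurableSet_interface Ω) (toL2 u))
    (extendByZero_mem u)
  map_add' u v := HHalf.toL2_injective <| by
    simp only [map_add, HHalf.toL2_mk]
  map_smul' c u := HHalf.toL2_injective <| by
    simp only [map_smul, HHalf.toL2_mk, RingHom.id_apply]

theorem toL2_extend (u : LionsMagenes Ω i) :
    HHalf.toL2 (extend u) =
      extendByZero (frontier (Ω i)) (measurableSet_interface Ω) (toL2 u) :=
  HHalf.toL2_mk _ _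

theorem extend_injective : Function.Injective (extend (Ω := Ω) (i := i)) := by
  intro u v h
  apply toL2_injective
  apply extendByZero_injective (measurableSet_interface Ω) (interface_subset Ω i)
  rw [← toL2_extend, ← toL2_extend, h]

/-- The norm `‖u‖ = ‖e u‖` in `H^{1/2}(∂Ωᵢ)`. -/
instance : NormedAddCommGroup (LionsMagenes Ω i) :=
  NormedAddCommGroup.induced (LionsMagenes Ω i) _ extend extend_injective

instance : InnerProductSpace ℝ (LionsMagenes Ω i) := InnerProductSpace.induced extend

theorem norm_eq (u : LionsMagenes Ω i) : ‖u‖ = ‖extend u‖ := rfl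

end LionsMagenes

/-! ### The pullback maps -/

/-- Let `X t` be spaces of (classes of) functions on `S t`, with inclusions `ι t` into `L²(S t)`.
The maps `ψ t : X 0 → X t` are the compositions `ψ t u = u ∘ (Φ t)⁻¹`, and their inverses are
`(ψ t)⁻¹ v = v ∘ Φ t`, whatever representatives of the classes are used. -/
def IsPullback {n : ℕ} (Φ Φinv : ℝ → EuclideanSpace ℝ (Fin n) → EuclideanSpace ℝ (Fin n))
    (S : ℝ≥0 → Set (EuclideanSpace ℝ (Fin n))) (X : ℝ≥0 → Type)
    [∀ t, NormedAddCommGroup (X t)] [∀ t, InnerProductSpace ℝ (X t)]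
    (ι : ∀ t, X t →ₗ[ℝ] L2Surface (S t)) (ψ : ∀ t, X 0 ≃ₗ[ℝ] X t) : Prop :=
  ∀ t : ℝ≥0,
    (∀ (u : X 0) (f : EuclideanSpace ℝ (Fin n) → ℝ), ι 0 u =ᵐ[surfaceMeasure (S 0)] f →
      ι t (ψ t u) =ᵐ[surfaceMeasure (S t)] f ∘ Φinv t) ∧
    (∀ (v : X t) (g : EuclideanSpace ℝ (Fin n) → ℝ), ι t v =ᵐ[surfaceMeasure (S t)] g →
      ι 0 ((ψ t).symm v) =ᵐ[surfaceMeasure (S 0)] g ∘ Φ t)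

/-- The composition maps `u ↦ u ∘ (Φ t)⁻¹` are well defined linear bijections `X 0 → X t`, and
they make `X` a compatible pair. -/
def IsPullbackCompatible {n : ℕ}
    (Φ Φinv : ℝ → EuclideanSpace ℝ (Fin n) → EuclideanSpace ℝ (Fin n))
    (S : ℝ≥0 → Set (EuclideanSpace ℝ (Fin n))) (X : ℝ≥0 → Type)
    [∀ t, NormedAddCommGroup (X t)] [∀ t, InnerProductSpace ℝ (X t)]
    (ι : ∀ t, X t →ₗ[ℝ] L2Surface (S t)) : Prop :=
  ∃ ψ : ∀ t, X 0 ≃ₗ[ℝ] X t, IsPullback Φ Φinv S X ι ψ ∧ IsCompatiblePair X ψ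

end

/-! ### Measurable dependence of the Hausdorff measure on a parameter -/

/-- The infimum of `∑ diam ^ d` over countable covers by open sets of diameter at most `r`. -/
noncomputable def openHausdorffContent {X : Type*} [EMetricSpace X] (d : ℝ) (r : ℝ≥0∞)
    (s : Set X) : ℝ≥0∞ :=
  ⨅ (U : ℕ → Set X) (_ : s ⊆ ⋃ k, U k) (_ : ∀ k, IsOpen (U k) ∧ Metric.ediam (U k) ≤ r),
    ∑' k, Metric.ediam (U k) ^ d

theorem exists_isOpen_superset_ediam_rpow_le {X : Type*} [EMetricSpace X] {d : ℝ} (hd : 0 < d)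
    {r ε : ℝ≥0∞} (hr : r ≠ 0) (hr' : r ≠ ∞) (hε : ε ≠ 0) (t : Set X)
    (ht : Metric.ediam t ≤ r / 2) :
    ∃ U, IsOpen U ∧ t ⊆ U ∧ Metric.ediam U ≤ r ∧
      Metric.ediam U ^ d ≤ (⨆ _ : t.Nonempty, Metric.ediam t ^ d) + ε := by
  rcases t.eq_empty_or_nonempty with rfl | hne
  · exact ⟨∅, isOpen_empty, subset_rfl, by simp, by simp [hd]⟩
  have hfin : Metric.ediam t ≠ ∞ :=
    (ht.trans_lt (ENNReal.div_lt_top hr' two_ne_zero)).ne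
  have hlt : Metric.ediam t < r := ht.trans_lt (ENNReal.half_lt_self hr hr')
  have hcont : Filter.Tendsto (fun δ : ℝ≥0 => Metric.ediam t + 2 * (δ : ℝ≥0∞))
      (nhdsWithin 0 (Ioi 0)) (nhds (Metric.ediam t)) := by
    have h1 : Continuous fun δ : ℝ≥0 => Metric.ediam t + 2 * (δ : ℝ≥0∞) :=
      continuous_const.add
        ((ENNReal.continuous_const_mul ENNReal.ofNat_ne_top).comp ENNReal.continuous_coe)
    simpa using (h1.tendsto 0).mono_left nhdsWithin_le_nhds
  have hpow : Filter.Tendsto (fun δ : ℝ≥0 => (Metric.ediam t + 2 * (δ : ℝ≥0∞)) ^ d)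
      (nhdsWithin 0 (Ioi 0)) (nhds (Metric.ediam t ^ d)) :=
    (ENNReal.continuous_rpow_const.tendsto _).comp hcont
  have hlt' : Metric.ediam t ^ d < Metric.ediam t ^ d + ε :=
    ENNReal.lt_add_right (ENNReal.rpow_ne_top_of_nonneg hd.le hfin) hε
  obtain ⟨δ, ⟨h1, h2⟩, h3⟩ := ((hcont.eventually_lt_const hlt).and
    (hpow.eventually_lt_const hlt') |>.and self_mem_nhdsWithin).exists
  refine ⟨Metric.thickening δ t, Metric.isOpen_thickening,
    Metric.self_subset_thickening (by exact_mod_cast h3) t,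
    (Metric.ediam_thickening_le δ).trans h1.le, ?_⟩
  simp only [hne, ciSup_unique]
  exact (ENNReal.rpow_le_rpow (Metric.ediam_thickening_le δ) hd.le).trans h2.le

theorem hausdorffMeasure_eq_iSup_openHausdorffContent {X : Type*} [EMetricSpace X]
    [MeasurableSpace X] [BorelSpace X] {d : ℝ} (hd : 0 < d) (s : Set X) :
    μH[d] s = ⨆ k : ℕ, openHausdorffContent d ((k : ℝ≥0∞) + 1)⁻¹ s := by
  rw [Measure.hausdorffMeasure_apply]
  apply le_antisymm
  · refine iSup₂_le fun r hr => ?_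
    obtain ⟨k, hk⟩ := ENNReal.exists_inv_nat_lt hr.ne'
    refine le_iSup_of_le k ?_
    refine le_iInf₂ fun U hU => le_iInf fun hU' => ?_
    refine iInf₂_le_of_le U hU (iInf_le_of_le (fun j => ?_) ?_)
    · refine (hU' j).2.trans (le_trans ?_ hk.le)
      exact ENNReal.inv_le_inv.2 le_self_add
    · exact ENNReal.tsum_le_tsum fun j => iSup_le fun _ => le_rfl
  · refine iSup_le fun k => ?_
    have hr : ((k : ℝ≥0∞) + 1)⁻¹ ≠ 0 :=
      ENNReal.inv_ne_zero.2 (ENNReal.add_ne_top.2 ⟨ENNReal.natCast_ne_top k, ENNReal.one_ne_top⟩)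
    have hr' : ((k : ℝ≥0∞) + 1)⁻¹ ≠ ∞ := ENNReal.inv_ne_top.2 (by simp)
    refine le_iSup₂_of_le (((k : ℝ≥0∞) + 1)⁻¹ / 2) (ENNReal.half_pos hr) ?_
    refine le_iInf₂ fun t ht => le_iInf fun ht' => ?_
    refine ENNReal.le_of_forall_pos_le_add fun ε hε _ => ?_
    obtain ⟨ε', hε', hsum⟩ := ENNReal.exists_pos_sum_of_countable'
      (ENNReal.coe_ne_zero.2 hε.ne') ℕ
    choose U hUo hUt hUr hUd using fun j =>
      exists_isOpen_superset_ediam_rpow_le hd hr hr' (hε' j).ne' (t j) (ht' j)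
    refine iInf₂_le_of_le U (ht.trans (iUnion_mono hUt))
      (iInf_le_of_le (fun j => ⟨hUo j, hUr j⟩) ?_)
    refine (ENNReal.tsum_le_tsum hUd).trans ?_
    rw [ENNReal.tsum_add]
    gcongr

/-- If `F` is jointly continuous and `K` is compact, then the Hausdorff measure of `F t '' K` is a
Borel function of `t`: the contents of open covers are upper semicontinuous. -/
theorem measurable_hausdorffMeasure_image {T X Y : Type*} [TopologicalSpace T] [MeasurableSpace T]
    [OpensMeasurableSpace T] [TopologicalSpace Y] [EMetricSpace X] [MeasurableSpace X]
    [BorelSpace X] {d : ℝ} (hd : 0 < d) {F : T → Y → X}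
    (hF : Continuous (Function.uncurry F)) {K : Set Y} (hK : IsCompact K) :
    Measurable fun t => μH[d] (F t '' K) := by
  simp only [hausdorffMeasure_eq_iSup_openHausdorffContent hd]
  refine Measurable.iSup fun k => measurable_of_Iio fun a => IsOpen.measurableSet ?_
  rw [isOpen_iff_mem_nhds]
  intro t ht
  simp only [mem_preimage, mem_Iio, openHausdorffContent, iInf_lt_iff] at ht
  obtain ⟨U, hU, hU', hlt⟩ := ht
  have hopen : ∀ᶠ t' in nhds t, ∀ y ∈ K, F t' y ∈ ⋃ j, U j := by
    refine hK.eventually_forall_of_forall_eventually fun y hy => ?_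
    exact hF.continuousAt.eventually_mem
      ((isOpen_iUnion fun j => (hU' j).1).mem_nhds (hU (mem_image_of_mem _ hy)))
  filter_upwards [hopen] with t' ht'
  simp only [mem_preimage, mem_Iio, openHausdorffContent, iInf_lt_iff]
  exact ⟨U, image_subset_iff.2 ht', hU', hlt⟩

theorem euclideanHausdorffMeasure_apply_eq {X : Type*} [EMetricSpace X] [MeasurableSpace X]
    [BorelSpace X] (d : ℕ) (s : Set X) :
    Measure.euclideanHausdorffMeasure d s =
      (Measure.addHaarScalarFactor (volume : Measure (EuclideanSpace ℝ (Fin d))) μH[d] : ℝ≥0∞) *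
        μH[d] s := by
  rw [Measure.euclideanHausdorffMeasure_def]
  rfl

theorem LipschitzOnWith.euclideanHausdorffMeasure_image_le {X Y : Type*} [EMetricSpace X]
    [MeasurableSpace X] [BorelSpace X] [EMetricSpace Y] [MeasurableSpace Y] [BorelSpace Y]
    {K : ℝ≥0} {f : X → Y} {s : Set X} (h : LipschitzOnWith K f s) (d : ℕ) :
    Measure.euclideanHausdorffMeasure d (f '' s) ≤
      (K : ℝ≥0∞) ^ d * Measure.euclideanHausdorffMeasure d s := by
  rw [euclideanHausdorffMeasure_apply_eq, euclideanHausdorffMeasure_apply_eq, mul_left_comm]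
  gcongr
  simpa using h.hausdorffMeasure_image_le (Nat.cast_nonneg d)

theorem measurable_euclideanHausdorffMeasure_image {T X Y : Type*} [TopologicalSpace T]
    [MeasurableSpace T] [OpensMeasurableSpace T] [TopologicalSpace Y] [EMetricSpace X]
    [MeasurableSpace X] [BorelSpace X] {d : ℕ} (hd : 0 < d) {F : T → Y → X}
    (hF : Continuous (Function.uncurry F)) {K : Set Y} (hK : IsCompact K) :
    Measurable fun t => Measure.euclideanHausdorffMeasure d (F t '' K) := by
  simp only [euclideanHausdorffMeasure_apply_eq]
  exact (measurable_hausdorffMeasure_image (Nat.cast_pos.2 hd) hF hK).const_mul _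

/-! ### Boundaries of Lipschitz domains have finite surface measure -/

theorem lipschitzWith_graph {n : ℕ} {V : Submodule ℝ (EuclideanSpace ℝ (Fin n))}
    {e : EuclideanSpace ℝ (Fin n)} (he : ‖e‖ = 1) {K : ℝ≥0} {σ : V → ℝ} (hσ : LipschitzWith K σ) :
    LipschitzWith (1 + K) fun z : V => (z : EuclideanSpace ℝ (Fin n)) + σ z • e := by
  refine (LipschitzWith.subtype_val _).add (LipschitzWith.of_dist_le_mul fun z z' => ?_)
  rw [dist_eq_norm, ← sub_smul, norm_smul, he, mul_one, ← dist_eq_norm]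
  exact hσ.dist_le_mul z z'

theorem orthogonalProjectionOnto_add_inner_smul {n : ℕ}
    {V : Submodule ℝ (EuclideanSpace ℝ (Fin n))} {e : EuclideanSpace ℝ (Fin n)} (he : ‖e‖ = 1)
    (hV : V = (Submodule.span ℝ {e})ᗮ) (y : EuclideanSpace ℝ (Fin n)) :
    (V.orthogonalProjectionOnto y : EuclideanSpace ℝ (Fin n)) + (inner ℝ e y : ℝ) • e = y := by
  subst hV
  have h := Submodule.starProjection_unit_singleton ℝ he y
  rw [← h, add_comm]
  exact Submodule.starProjection_add_starProjection_orthogonal _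

theorem euclideanHausdorffMeasure_graph_lt_top {n : ℕ}
    {V : Submodule ℝ (EuclideanSpace ℝ (Fin n))} {e : EuclideanSpace ℝ (Fin n)} (he : ‖e‖ = 1)
    (hV : V = (Submodule.span ℝ {e})ᗮ) {K : ℝ≥0} {σ : V → ℝ} (hσ : LipschitzWith K σ) (R : ℝ) :
    Measure.euclideanHausdorffMeasure (n - 1) ((fun z : V =>
      (z : EuclideanSpace ℝ (Fin n)) + σ z • e) '' Metric.closedBall 0 R) < ∞ := by
  have hfin : Module.finrank ℝ V = n - 1 := by
    have h1 := Submodule.finrank_add_finrank_orthogonal (Submodule.span ℝ {e})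
    rw [finrank_span_singleton (by rintro rfl; simp at he), finrank_euclideanSpace_fin, ← hV] at h1
    omega
  refine ((lipschitzWith_graph he hσ).lipschitzOnWith.euclideanHausdorffMeasure_image_le
    (n - 1)).trans_lt (ENNReal.mul_lt_top (by simp) ?_)
  rw [euclideanHausdorffMeasure_apply_eq]
  refine ENNReal.mul_lt_top ENNReal.coe_lt_top ?_
  rw [← hfin]
  exact (isCompact_closedBall _ _).measure_lt_top

/-- In a ball in which `Ω` is an epigraph, the boundary of `Ω` is contained in the graph. -/
theorem frontier_inter_ball_subset_graph {n : ℕ} {Ω : Set (EuclideanSpace ℝ (Fin n))}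
    (hΩ : IsOpen Ω) {V : Submodule ℝ (EuclideanSpace ℝ (Fin n))} {e : EuclideanSpace ℝ (Fin n)}
    (he : ‖e‖ = 1) (hV : V = (Submodule.span ℝ {e})ᗮ) {σ : V → ℝ} (hσ : Continuous σ)
    {x : EuclideanSpace ℝ (Fin n)} {r : ℝ}
    (hmem : ∀ (z : V) (s : ℝ), (z : EuclideanSpace ℝ (Fin n)) + s • e ∈ Metric.ball x r →
      ((z : EuclideanSpace ℝ (Fin n)) + s • e ∈ Ω ↔ σ z < s)) :
    frontier Ω ∩ Metric.ball x r ⊆ (fun z : V => (z : EuclideanSpace ℝ (Fin n)) + σ z • e) ''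
      Metric.closedBall 0 (‖x‖ + r) := by
  have hP : Continuous fun y : EuclideanSpace ℝ (Fin n) => σ (V.orthogonalProjectionOnto y) :=
    hσ.comp V.orthogonalProjectionOnto.continuous
  have hin : Continuous fun y : EuclideanSpace ℝ (Fin n) => (inner ℝ e y : ℝ) :=
    continuous_const.inner continuous_id
  have hmem' : ∀ y ∈ Metric.ball x r,
      (y ∈ Ω ↔ σ (V.orthogonalProjectionOnto y) < inner ℝ e y) := by
    intro y hy
    have := hmem (V.orthogonalProjectionOnto y) (inner ℝ e y)
    rw [orthogonalProjectionOnto_add_inner_smul he hV y] at this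
    exact this hy
  rintro y ⟨hy, hyr⟩
  rw [hΩ.frontier_eq] at hy
  have h1 : inner ℝ e y ≤ σ (V.orthogonalProjectionOnto y) :=
    not_lt.1 fun h => hy.2 ((hmem' y hyr).2 h)
  have h2 : σ (V.orthogonalProjectionOnto y) ≤ inner ℝ e y := by
    by_contra! h
    have hev : ∀ᶠ y' in nhds y, y' ∉ Ω := by
      filter_upwards [hin.continuousAt.eventually_lt hP.continuousAt h,
        Metric.isOpen_ball.mem_nhds hyr] with y' h1 h2 h3
      exact lt_asymm h1 ((hmem' y' h2).1 h3)
    exact (mem_closure_iff_frequently.1 hy.1) hev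
  refine ⟨V.orthogonalProjectionOnto y, ?_, ?_⟩
  · rw [mem_closedBall_zero_iff]
    refine (V.norm_orthogonalProjectionOnto_apply_le y).trans ?_
    have := norm_le_norm_add_norm_sub' y x
    rw [← dist_eq_norm] at this
    linarith [Metric.mem_ball.1 hyr]
  · dsimp only
    rw [le_antisymm h2 h1]
    exact orthogonalProjectionOnto_add_inner_smul he hV y

theorem IsBoundedLipschitzDomain.isCompact_frontier {n : ℕ}
    {Ω : Set (EuclideanSpace ℝ (Fin n))} (hΩ : IsBoundedLipschitzDomain Ω) :
    IsCompact (frontier Ω) :=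
  Metric.isCompact_of_isClosed_isBounded isClosed_frontier
    (hΩ.isBounded.closure.subset frontier_subset_closure)

theorem IsBoundedLipschitzDomain.euclideanHausdorffMeasure_frontier_lt_top {n : ℕ}
    {Ω : Set (EuclideanSpace ℝ (Fin n))} (hΩ : IsBoundedLipschitzDomain Ω) :
    Measure.euclideanHausdorffMeasure (n - 1) (frontier Ω) < ∞ := by
  have h : ∀ x ∈ frontier Ω, ((Measure.euclideanHausdorffMeasure (n - 1)).restrict
      (frontier Ω)).FiniteAtFilter (nhdsWithin x (frontier Ω)) := by
    intro x hx
    obtain ⟨e, he, K, σ, hσ, r, hr, hmem⟩ := hΩ.lipschitz_boundary x hx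
    have hlt := (measure_mono (frontier_inter_ball_subset_graph hΩ.isOpen he rfl hσ.continuous
      hmem)).trans_lt (euclideanHausdorffMeasure_graph_lt_top he rfl hσ _)
    refine ⟨Metric.ball x r, mem_nhdsWithin_of_mem_nhds (Metric.ball_mem_nhds x hr), ?_⟩
    rwa [Measure.restrict_apply Metric.isOpen_ball.measurableSet, inter_comm]
  simpa using hΩ.isCompact_frontier.measure_lt_top_of_nhdsWithin h

/-! ### Composition with a bi-Lipschitz map -/

theorem eLpNorm_two_comp_le {α β : Type*} [MeasurableSpace α] [MeasurableSpace β]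
    {μ : Measure α} {ν : Measure β} {g : α → β} (hg : Measurable g) {c : ℝ≥0}
    (h : μ.map g ≤ c • ν) {f : β → ℝ} (hf : AEStronglyMeasurable f ν) :
    eLpNorm (f ∘ g) 2 μ ≤ (c ^ (1 / 2 : ℝ) : ℝ≥0) * eLpNorm f 2 ν := by
  have hac : μ.map g ≪ ν := (Measure.absolutelyContinuous_of_le h).trans
    Measure.smul_absolutelyContinuous
  rw [← eLpNorm_map_measure (hf.mono_ac hac) hg.aemeasurable]
  refine (eLpNorm_mono_measure f h).trans (le_of_eq ?_)
  rw [eLpNorm_smul_measure_of_ne_top' (by simp)]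
  simp [ENNReal.smul_def]

theorem MeasureTheory.MemLp.two_comp {α β : Type*} [MeasurableSpace α] [MeasurableSpace β]
    {μ : Measure α} {ν : Measure β} {g : α → β} (hg : Measurable g) {c : ℝ≥0}
    (h : μ.map g ≤ c • ν) {f : β → ℝ} (hf : MemLp f 2 ν) : MemLp (f ∘ g) 2 μ := by
  have hac : μ.map g ≪ ν := (Measure.absolutelyContinuous_of_le h).trans
    Measure.smul_absolutelyContinuous
  exact ⟨(hf.1.mono_ac hac).comp_measurable hg, (eLpNorm_two_comp_le hg h hf.1).trans_lt
    (ENNReal.mul_lt_top ENNReal.coe_lt_top hf.2)⟩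

/-- `g` and `h` are mutually inverse homeomorphisms of `ℝⁿ` that restrict to `L`-Lipschitz maps
between `S` and `T`. -/
structure IsBiLipschitzPair {n : ℕ} (g h : EuclideanSpace ℝ (Fin n) → EuclideanSpace ℝ (Fin n))
    (S T : Set (EuclideanSpace ℝ (Fin n))) (L : ℝ≥0) : Prop where
  continuous : Continuous g
  continuous_inv : Continuous h
  left_inv : Function.LeftInverse h g
  right_inv : Function.RightInverse h g
  mapsTo : MapsTo g S T
  mapsTo_inv : MapsTo h T S
  lipschitz : LipschitzOnWith L g S
  lipschitz_inv : LipschitzOnWith L h T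

/-- The norm of the composition operator on `L²` is bounded by this constant. -/
noncomputable def l2Const (n : ℕ) (L : ℝ≥0) : ℝ≥0 := (L ^ (n - 1)) ^ (1 / 2 : ℝ)

/-- The composition operator scales the `H^{1/2}` seminorm by at most this constant. -/
noncomputable def quotConst (n : ℕ) (L : ℝ≥0) : ℝ≥0 :=
  L ^ ((n : ℝ) / 2) * (L ^ (n - 1) * L ^ (n - 1)) ^ (1 / 2 : ℝ)

theorem HHalf.norm_sq_eq_add {n : ℕ} {S : Set (EuclideanSpace ℝ (Fin n))} (u : HHalf S) :
    ‖u‖ ^ 2 = ‖HHalf.toL2 u‖ ^ 2 + ‖HHalf.quot u‖ ^ 2 := by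
  change ‖HHalf.graphMap u‖ ^ 2 = _
  rw [WithLp.prod_norm_sq_eq_of_L2]
  rfl

namespace IsBiLipschitzPair

variable {n : ℕ} {g h : EuclideanSpace ℝ (Fin n) → EuclideanSpace ℝ (Fin n)}
  {S T : Set (EuclideanSpace ℝ (Fin n))} {L : ℝ≥0}

theorem symm (P : IsBiLipschitzPair g h S T L) : IsBiLipschitzPair h g T S L :=
  ⟨P.continuous_inv, P.continuous, P.right_inv, P.left_inv, P.mapsTo_inv, P.mapsTo,
    P.lipschitz_inv, P.lipschitz⟩

theorem map_mem_iff (P : IsBiLipschitzPair g h S T L) (x : EuclideanSpace ℝ (Fin n)) :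
    g x ∈ T ↔ x ∈ S :=
  ⟨fun hx => P.left_inv x ▸ P.mapsTo_inv hx, fun hx => P.mapsTo hx⟩

theorem map_surfaceMeasure_le (P : IsBiLipschitzPair g h S T L) :
    (surfaceMeasure S).map g ≤ (L ^ (n - 1) : ℝ≥0) • surfaceMeasure T := by
  refine Measure.le_iff.2 fun A hA => ?_
  rw [Measure.map_apply P.continuous.measurable hA, Measure.smul_apply, surfaceMeasure,
    surfaceMeasure, Measure.restrict_apply hA,
    Measure.restrict_apply (P.continuous.measurable hA)]
  have hsub : g ⁻¹' A ∩ S ⊆ h '' (A ∩ T) := fun x hx =>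
    ⟨g x, ⟨hx.1, P.mapsTo hx.2⟩, P.left_inv x⟩
  refine (measure_mono hsub).trans (((P.lipschitz_inv.mono
    inter_subset_right).euclideanHausdorffMeasure_image_le (n - 1)).trans (le_of_eq ?_))
  rw [ENNReal.smul_def, smul_eq_mul, ENNReal.coe_pow]

theorem quasiMeasurePreserving (P : IsBiLipschitzPair g h S T L) :
    Measure.QuasiMeasurePreserving g (surfaceMeasure S) (surfaceMeasure T) :=
  ⟨P.continuous.measurable, (Measure.absolutelyContinuous_of_le P.map_surfaceMeasure_le).trans
    Measure.smul_absolutelyContinuous⟩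

theorem map_surfaceMeasureSq_le [IsFiniteMeasure (surfaceMeasure S)]
    [IsFiniteMeasure (surfaceMeasure T)] (P : IsBiLipschitzPair g h S T L) :
    (surfaceMeasureSq S).map (Prod.map g g) ≤
      (L ^ (n - 1) * L ^ (n - 1) : ℝ≥0) • surfaceMeasureSq T := by
  rw [← Measure.map_prod_map _ _ P.continuous.measurable P.continuous.measurable]
  refine (Measure.prod_mono P.map_surfaceMeasure_le P.map_surfaceMeasure_le).trans (le_of_eq ?_)
  ext A hA
  simp only [ENNReal.smul_def, Measure.prod_smul_left, Measure.prod_smul_right, smul_smul,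
    ENNReal.coe_mul]

/-- The composition operator `u ↦ u ∘ g` from `L²(T)` to `L²(S)`. -/
noncomputable def compL2 (P : IsBiLipschitzPair g h S T L) : L2Surface T →ₗ[ℝ] L2Surface S where
  toFun u := ((Lp.memLp u).two_comp P.continuous.measurable P.map_surfaceMeasure_le).toLp
  map_add' u v := by
    rw [← MemLp.toLp_add, MemLp.toLp_eq_toLp_iff]
    exact P.quasiMeasurePreserving.ae_eq_comp (Lp.coeFn_add u v)
  map_smul' c u := by
    rw [RingHom.id_apply, ← MemLp.toLp_const_smul, MemLp.toLp_eq_toLp_iff]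
    exact P.quasiMeasurePreserving.ae_eq_comp (Lp.coeFn_smul c u)

theorem coeFn_compL2 (P : IsBiLipschitzPair g h S T L) (u : L2Surface T) :
    P.compL2 u =ᵐ[surfaceMeasure S] u ∘ g :=
  MemLp.coeFn_toLp
    ((Lp.memLp u).two_comp P.continuous.measurable P.map_surfaceMeasure_le)

theorem compL2_ae_eq (P : IsBiLipschitzPair g h S T L) {u : L2Surface T}
    {f : EuclideanSpace ℝ (Fin n) → ℝ} (hf : u =ᵐ[surfaceMeasure T] f) :
    P.compL2 u =ᵐ[surfaceMeasure S] f ∘ g :=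
  (P.coeFn_compL2 u).trans (P.quasiMeasurePreserving.ae_eq_comp hf)

theorem compL2_symm_compL2 (P : IsBiLipschitzPair g h S T L) (u : L2Surface S) :
    P.compL2 (P.symm.compL2 u) = u := by
  refine Lp.ext ((P.compL2_ae_eq (P.symm.coeFn_compL2 u)).trans ?_)
  rw [Function.comp_assoc, P.left_inv.id]
  rfl

theorem norm_compL2_le (P : IsBiLipschitzPair g h S T L) (u : L2Surface T) :
    ‖P.compL2 u‖ ≤ l2Const n L * ‖u‖ := by
  have h1 := eLpNorm_two_comp_le P.continuous.measurable P.map_surfaceMeasure_le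
    (Lp.aestronglyMeasurable u)
  rw [Lp.norm_def, Lp.norm_def, eLpNorm_congr_ae (P.coeFn_compL2 u)]
  refine (ENNReal.toReal_mono (ENNReal.mul_ne_top ENNReal.coe_ne_top (Lp.eLpNorm_ne_top u))
    h1).trans (le_of_eq ?_)
  rw [ENNReal.toReal_mul, ENNReal.coe_toReal, l2Const]

/-- The linear bijection `u ↦ u ∘ h` from `L²(S)` to `L²(T)`, with inverse `v ↦ v ∘ g`. -/
noncomputable def equivL2 (P : IsBiLipschitzPair g h S T L) : L2Surface S ≃ₗ[ℝ] L2Surface T where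
  __ := P.symm.compL2
  invFun := P.compL2
  left_inv u := P.compL2_symm_compL2 u
  right_inv v := P.symm.compL2_symm_compL2 v

theorem norm_diffQuot_comp_le (P : IsBiLipschitzPair g h S T L)
    (f : EuclideanSpace ℝ (Fin n) → ℝ) {p : EuclideanSpace ℝ (Fin n) × EuclideanSpace ℝ (Fin n)}
    (h1 : p.1 ∈ S) (h2 : p.2 ∈ S) :
    ‖diffQuot (f ∘ g) p‖ ≤ (L ^ ((n : ℝ) / 2) : ℝ≥0) * ‖(diffQuot f ∘ Prod.map g g) p‖ := by
  rcases eq_or_ne p.1 p.2 with hp | hp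
  · simp [diffQuot, hp]
  simp only [diffQuot, Function.comp_apply, Prod.map_fst, Prod.map_snd, norm_div, NNReal.coe_rpow,
    Real.norm_of_nonneg (Real.rpow_nonneg dist_nonneg _)]
  have hd : 0 < dist p.1 p.2 := dist_pos.2 hp
  have hd' : 0 < dist (g p.1) (g p.2) := dist_pos.2 fun h => hp (P.left_inv.injective h)
  rw [mul_div_assoc', div_le_div_iff₀ (by positivity) (by positivity)]
  have hle : dist (g p.1) (g p.2) ^ ((n : ℝ) / 2) ≤
      (L : ℝ) ^ ((n : ℝ) / 2) * dist p.1 p.2 ^ ((n : ℝ) / 2) := by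
    rw [← Real.mul_rpow L.coe_nonneg hd.le]
    exact Real.rpow_le_rpow hd'.le (P.lipschitz.dist_le_mul _ h1 _ h2) (by positivity)
  calc ‖f (g p.1) - f (g p.2)‖ * dist (g p.1) (g p.2) ^ ((n : ℝ) / 2)
      ≤ ‖f (g p.1) - f (g p.2)‖ * ((L : ℝ) ^ ((n : ℝ) / 2) * dist p.1 p.2 ^ ((n : ℝ) / 2)) := by
        gcongr
    _ = _ := by ring

variable [IsFiniteMeasure (surfaceMeasure S)] [IsFiniteMeasure (surfaceMeasure T)]

theorem eLpNorm_diffQuot_comp_le (P : IsBiLipschitzPair g h S T L) (hS : MeasurableSet S)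
    {f : EuclideanSpace ℝ (Fin n) → ℝ}
    (hf : AEStronglyMeasurable (diffQuot f) (surfaceMeasureSq T)) :
    eLpNorm (diffQuot (f ∘ g)) 2 (surfaceMeasureSq S) ≤
      quotConst n L * eLpNorm (diffQuot f) 2 (surfaceMeasureSq T) := by
  have hae : ∀ᵐ p ∂surfaceMeasureSq S, ‖diffQuot (f ∘ g) p‖ ≤
      (L ^ ((n : ℝ) / 2) : ℝ≥0) * ‖(diffQuot f ∘ Prod.map g g) p‖ := by
    have hm : ∀ᵐ x ∂surfaceMeasure S, x ∈ S := ae_restrict_mem hS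
    filter_upwards [Measure.quasiMeasurePreserving_fst.ae hm,
      Measure.quasiMeasurePreserving_snd.ae hm] with p h1 h2
    exact P.norm_diffQuot_comp_le f h1 h2
  refine (eLpNorm_le_nnreal_smul_eLpNorm_of_ae_le_mul hae 2).trans ?_
  rw [ENNReal.smul_def, smul_eq_mul, quotConst, ENNReal.coe_mul, mul_assoc]
  gcongr
  exact eLpNorm_two_comp_le (P.continuous.prodMap P.continuous).measurable
    P.map_surfaceMeasureSq_le hf

theorem compL2_mem_hHalf (P : IsBiLipschitzPair g h S T L) (hS : MeasurableSet S)
    {u : L2Surface T} (hu : u ∈ hHalfSubmodule T) : P.compL2 u ∈ hHalfSubmodule S := by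
  rw [HHalf.mem_hHalf] at hu ⊢
  rw [memLp_congr_ae (diffQuot_congr (P.coeFn_compL2 u))]
  refine ⟨?_, (P.eLpNorm_diffQuot_comp_le hS hu.1).trans_lt
    (ENNReal.mul_lt_top ENNReal.coe_lt_top hu.2)⟩
  have h2 : Measurable (u ∘ g) :=
    ((Lp.stronglyMeasurable u).comp_measurable P.continuous.measurable).measurable
  exact (((h2.comp measurable_fst).sub (h2.comp measurable_snd)).div
    ((measurable_fst.dist measurable_snd).pow_const _)).aestronglyMeasurable

/-- The composition operator `u ↦ u ∘ g` from `H^{1/2}(T)` to `H^{1/2}(S)`. -/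
noncomputable def compHHalf (P : IsBiLipschitzPair g h S T L) (hS : MeasurableSet S) :
    HHalf T →ₗ[ℝ] HHalf S where
  toFun u := HHalf.mk (P.compL2 (HHalf.toL2 u)) (P.compL2_mem_hHalf hS (HHalf.toL2_mem u))
  map_add' u v := HHalf.toL2_injective <| by simp only [map_add, HHalf.toL2_mk]
  map_smul' c u := HHalf.toL2_injective <| by
    simp only [map_smul, HHalf.toL2_mk, RingHom.id_apply]

theorem toL2_compHHalf (P : IsBiLipschitzPair g h S T L) (hS : MeasurableSet S) (u : HHalf T) :
    HHalf.toL2 (P.compHHalf hS u) = P.compL2 (HHalf.toL2 u) := rfl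

theorem norm_quot_compHHalf_le (P : IsBiLipschitzPair g h S T L) (hS : MeasurableSet S)
    (u : HHalf T) :
    ‖HHalf.quot (P.compHHalf hS u)‖ ≤ quotConst n L * ‖HHalf.quot u‖ := by
  have h1 := P.eLpNorm_diffQuot_comp_le hS (HHalf.memLp_diffQuot u).1
  change ‖MemLp.toLp _ (HHalf.memLp_diffQuot _)‖ ≤ _ * ‖MemLp.toLp _ (HHalf.memLp_diffQuot u)‖
  rw [Lp.norm_toLp, Lp.norm_toLp, toL2_compHHalf,
    eLpNorm_congr_ae (diffQuot_congr (P.coeFn_compL2 _))]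
  refine (ENNReal.toReal_mono (ENNReal.mul_ne_top ENNReal.coe_ne_top
    (HHalf.memLp_diffQuot u).2.ne) h1).trans (le_of_eq ?_)
  rw [ENNReal.toReal_mul, ENNReal.coe_toReal]

theorem norm_compHHalf_le (P : IsBiLipschitzPair g h S T L) (hS : MeasurableSet S)
    (u : HHalf T) : ‖P.compHHalf hS u‖ ≤ (l2Const n L + quotConst n L : ℝ) * ‖u‖ := by
  have h1 := P.norm_compL2_le (HHalf.toL2 u)
  have h2 := P.norm_quot_compHHalf_le hS u
  refine le_of_sq_le_sq ?_ (by positivity)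
  rw [HHalf.norm_sq_eq_add, mul_pow, HHalf.norm_sq_eq_add u, toL2_compHHalf]
  have h1' := pow_le_pow_left₀ (norm_nonneg _) h1 2
  have h2' := pow_le_pow_left₀ (norm_nonneg _) h2 2
  have ha := (l2Const n L).coe_nonneg
  have hb := (quotConst n L).coe_nonneg
  have h3 : (l2Const n L : ℝ) ^ 2 ≤ (l2Const n L + quotConst n L : ℝ) ^ 2 := by gcongr; linarith
  have h4 : (quotConst n L : ℝ) ^ 2 ≤ (l2Const n L + quotConst n L : ℝ) ^ 2 := by gcongr; linarith
  rw [mul_pow] at h1' h2'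
  rw [mul_add]
  exact add_le_add (h1'.trans (by gcongr)) (h2'.trans (by gcongr))

/-- The linear bijection `u ↦ u ∘ h` from `H^{1/2}(S)` to `H^{1/2}(T)`. -/
noncomputable def equivHHalf (P : IsBiLipschitzPair g h S T L) (hS : MeasurableSet S)
    (hT : MeasurableSet T) : HHalf S ≃ₗ[ℝ] HHalf T where
  __ := P.symm.compHHalf hT
  invFun := P.compHHalf hS
  left_inv u := HHalf.toL2_injective (P.compL2_symm_compL2 (HHalf.toL2 u))
  right_inv v := HHalf.toL2_injective (P.symm.compL2_symm_compL2 (HHalf.toL2 v))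

end IsBiLipschitzPair

/-! ### Completeness and separability -/

namespace HHalf

variable {n : ℕ} {S : Set (EuclideanSpace ℝ (Fin n))}

theorem isometry_graphMap : Isometry (graphMap (S := S)) :=
  AddMonoidHomClass.isometry_of_norm _ fun _ => rfl

theorem continuous_toL2 : Continuous (toL2 (S := S)) :=
  AddMonoidHomClass.continuous_of_bound _ 1 fun u => by
    rw [one_mul]
    refine le_of_sq_le_sq ?_ (norm_nonneg _)
    rw [norm_sq_eq_add]
    exact le_add_of_nonneg_right (sq_nonneg _)

theorem coeFn_quot (u : HHalf S) : quot u =ᵐ[surfaceMeasureSq S] diffQuot (toL2 u) :=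
  MemLp.coeFn_toLp (memLp_diffQuot u)

/-- The graph of the difference quotient is closed in `L²(S) ⊕ L²(S × S)`. -/
theorem ae_eq_diffQuot_of_tendsto {u : ℕ → HHalf S} {w : L2Surface S}
    {q : Lp ℝ 2 (surfaceMeasureSq S)}
    (hw : Filter.Tendsto (fun k => toL2 (u k)) Filter.atTop (nhds w))
    (hq : Filter.Tendsto (fun k => quot (u k)) Filter.atTop (nhds q)) :
    q =ᵐ[surfaceMeasureSq S] diffQuot w := by
  obtain ⟨a, ha, ha'⟩ := (tendstoInMeasure_of_tendsto_Lp hw).exists_seq_tendsto_ae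
  obtain ⟨b, hb, hb'⟩ :=
    (tendstoInMeasure_of_tendsto_Lp (hq.comp ha.tendsto_atTop)).exists_seq_tendsto_ae
  filter_upwards [Measure.quasiMeasurePreserving_fst.ae ha',
    Measure.quasiMeasurePreserving_snd.ae ha', hb', ae_all_iff.2 fun k => coeFn_quot (u k)]
    with p h1 h2 h3 h4
  have h5 : Filter.Tendsto (fun k => diffQuot (toL2 (u (a (b k)))) p) Filter.atTop
      (nhds (diffQuot w p)) :=
    ((h1.sub h2).div_const _).comp hb.tendsto_atTop
  refine tendsto_nhds_unique (h3.congr fun k => ?_) h5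
  exact h4 (a (b k))

theorem isClosed_range_graphMap : IsClosed (range (graphMap (S := S))) := by
  refine IsSeqClosed.isClosed fun x y hx hy => ?_
  choose u hu using hx
  have hcont := (WithLp.prod_continuous_ofLp 2 (L2Surface S) (Lp ℝ 2 (surfaceMeasureSq S))).tendsto y
  have h1 := hcont.comp hy
  have hw : Filter.Tendsto (fun k => toL2 (u k)) Filter.atTop (nhds y.fst) :=
    ((continuous_fst.tendsto _).comp h1).congr fun k => by
      simp only [Function.comp_apply, ← hu k]; rfl
  have hq : Filter.Tendsto (fun k => quot (u k)) Filter.atTop (nhds y.snd) :=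
    ((continuous_snd.tendsto _).comp h1).congr fun k => by
      simp only [Function.comp_apply, ← hu k]; rfl
  have hae := ae_eq_diffQuot_of_tendsto hw hq
  have hmem : y.fst ∈ hHalfSubmodule S := (mem_hHalf _).2 ((memLp_congr_ae hae).1 (Lp.memLp _))
  refine ⟨mk y.fst hmem, ?_⟩
  have hsnd : quot (mk y.fst hmem) = y.snd := Lp.ext ((coeFn_quot _).trans hae.symm)
  exact WithLp.ofLp_injective 2 (Prod.ext rfl hsnd)

instance : CompleteSpace (HHalf S) :=
  (completeSpace_iff_isComplete_range isometry_graphMap.isUniformInducing).2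
    isClosed_range_graphMap.isComplete

theorem secondCountableTopology [IsFiniteMeasure (surfaceMeasure S)] :
    SecondCountableTopology (HHalf S) := by
  have : Fact ((2 : ℝ≥0∞) ≠ ∞) := ⟨ENNReal.ofNat_ne_top⟩
  have h1 : SecondCountableTopology (L2Surface S) := inferInstance
  have h2 : SecondCountableTopology (Lp ℝ 2 (surfaceMeasureSq S)) := inferInstance
  exact isometry_graphMap.isEmbedding.toIsInducing.secondCountableTopology

end HHalf

theorem L2Surface.secondCountableTopology {n : ℕ} (S : Set (EuclideanSpace ℝ (Fin n)))
    [IsFiniteMeasure (surfaceMeasure S)] : SecondCountableTopology (L2Surface S) := by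
  have : Fact ((2 : ℝ≥0∞) ≠ ∞) := ⟨ENNReal.ofNat_ne_top⟩
  infer_instance

theorem coeFn_extendByZero {n : ℕ} {S : Set (EuclideanSpace ℝ (Fin n))}
    (T : Set (EuclideanSpace ℝ (Fin n))) (hS : MeasurableSet S) (u : L2Surface S) :
    extendByZero T hS u =ᵐ[surfaceMeasure T] S.indicator u :=
  MemLp.coeFn_toLp (memLp_indicator_surface T hS u)

theorem isometry_extendByZero {n : ℕ} {S T : Set (EuclideanSpace ℝ (Fin n))}
    (hS : MeasurableSet S) (hST : S ⊆ T) : Isometry (extendByZero (S := S) T hS) :=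
  AddMonoidHomClass.isometry_of_norm _ fun u => by
    have h : (surfaceMeasure T).restrict S = surfaceMeasure S := by
      rw [surfaceMeasure, surfaceMeasure, Measure.restrict_restrict hS,
        inter_eq_self_of_subset_left hST]
    rw [Lp.norm_def, Lp.norm_def, eLpNorm_congr_ae (coeFn_extendByZero T hS u),
      eLpNorm_indicator_eq_eLpNorm_restrict hS, h]

namespace LionsMagenes

variable {n : ℕ} {Ω : Fin 2 → Set (EuclideanSpace ℝ (Fin n))} {i : Fin 2}

theorem isometry_extend : Isometry (extend (Ω := Ω) (i := i)) :=
  AddMonoidHomClass.isometry_of_norm _ fun _ => rfl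

theorem isClosed_range_extend : IsClosed (range (extend (Ω := Ω) (i := i))) := by
  have h : range (extend (Ω := Ω) (i := i)) = HHalf.toL2 ⁻¹'
      range (extendByZero (frontier (Ω i)) (measurableSet_interface Ω)) := by
    ext v
    constructor
    · rintro ⟨u, rfl⟩
      exact ⟨toL2 u, (toL2_extend u).symm⟩
    · rintro ⟨w, hw⟩
      have hmem : w ∈ lionsMagenesSubmodule Ω i := by
        rw [lionsMagenesSubmodule, Submodule.mem_comap, hw]
        exact HHalf.toL2_mem v
      exact ⟨(⟨w, hmem⟩ : lionsMagenesSubmodule Ω i),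
        HHalf.toL2_injective ((toL2_extend _).trans hw)⟩
  rw [h]
  exact (isometry_extendByZero _ (interface_subset Ω i)).isClosedEmbedding.isClosed_range.preimage
    HHalf.continuous_toL2

instance : CompleteSpace (LionsMagenes Ω i) :=
  (completeSpace_iff_isComplete_range isometry_extend.isUniformInducing).2
    isClosed_range_extend.isComplete

theorem secondCountableTopology [IsFiniteMeasure (surfaceMeasure (frontier (Ω i)))] :
    SecondCountableTopology (LionsMagenes Ω i) := by
  have := HHalf.secondCountableTopology (S := frontier (Ω i))
  exact isometry_extend.isEmbedding.toIsInducing.secondCountableTopology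

end LionsMagenes

/-! ### Composition operators on the Lions–Magenes spaces -/

namespace IsBiLipschitzPair

variable {n : ℕ} {g h : EuclideanSpace ℝ (Fin n) → EuclideanSpace ℝ (Fin n)} {L L' : ℝ≥0}

theorem compL2_extendByZero {S T S' T' : Set (EuclideanSpace ℝ (Fin n))}
    (P : IsBiLipschitzPair g h S T L) (Q : IsBiLipschitzPair g h S' T' L')
    (hS : MeasurableSet S') (hT : MeasurableSet T') (u : L2Surface T') :
    P.compL2 (extendByZero T hT u) = extendByZero S hS (Q.compL2 u) := by
  refine Lp.ext ((P.compL2_ae_eq (coeFn_extendByZero T hT u)).trans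
    (Filter.EventuallyEq.trans ?_ (coeFn_extendByZero S hS _).symm))
  refine Filter.EventuallyEq.trans (Filter.Eventually.of_forall fun x => ?_)
    (indicator_congr_surface S hS (Q.coeFn_compL2 u)).symm
  by_cases hx : x ∈ S'
  · simp [hx, (Q.map_mem_iff x).2 hx]
  · simp [hx, mt (Q.map_mem_iff x).1 hx]

variable {Ω Ω' : Fin 2 → Set (EuclideanSpace ℝ (Fin n))} {i : Fin 2}
  [IsFiniteMeasure (surfaceMeasure (frontier (Ω i)))]
  [IsFiniteMeasure (surfaceMeasure (frontier (Ω' i)))]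

theorem compL2_mem_lionsMagenes (P : IsBiLipschitzPair g h (frontier (Ω i)) (frontier (Ω' i)) L)
    (Q : IsBiLipschitzPair g h (interface Ω) (interface Ω') L') {u : L2Surface (interface Ω')}
    (hu : u ∈ lionsMagenesSubmodule Ω' i) : Q.compL2 u ∈ lionsMagenesSubmodule Ω i := by
  rw [lionsMagenesSubmodule, Submodule.mem_comap] at hu ⊢
  rw [← P.compL2_extendByZero Q (measurableSet_interface Ω) (measurableSet_interface Ω')]
  exact P.compL2_mem_hHalf isClosed_frontier.measurableSet hu

/-- The composition operator `u ↦ u ∘ g` between Lions–Magenes spaces. -/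
noncomputable def compLionsMagenes
    (P : IsBiLipschitzPair g h (frontier (Ω i)) (frontier (Ω' i)) L)
    (Q : IsBiLipschitzPair g h (interface Ω) (interface Ω') L') :
    LionsMagenes Ω' i →ₗ[ℝ] LionsMagenes Ω i :=
  (Q.compL2 ∘ₗ LionsMagenes.toL2).codRestrict (lionsMagenesSubmodule Ω i)
    fun u => P.compL2_mem_lionsMagenes Q (LionsMagenes.toL2_mem u)

theorem toL2_compLionsMagenes (P : IsBiLipschitzPair g h (frontier (Ω i)) (frontier (Ω' i)) L)
    (Q : IsBiLipschitzPair g h (interface Ω) (interface Ω') L') (u : LionsMagenes Ω' i) :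
    LionsMagenes.toL2 (P.compLionsMagenes Q u) = Q.compL2 (LionsMagenes.toL2 u) := rfl

theorem extend_compLionsMagenes (P : IsBiLipschitzPair g h (frontier (Ω i)) (frontier (Ω' i)) L)
    (Q : IsBiLipschitzPair g h (interface Ω) (interface Ω') L') (u : LionsMagenes Ω' i) :
    LionsMagenes.extend (P.compLionsMagenes Q u) =
      P.compHHalf isClosed_frontier.measurableSet (LionsMagenes.extend u) := by
  refine HHalf.toL2_injective ?_
  rw [toL2_compHHalf, LionsMagenes.toL2_extend, LionsMagenes.toL2_extend, toL2_compLionsMagenes,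
    P.compL2_extendByZero Q (measurableSet_interface Ω) (measurableSet_interface Ω')]

/-- The linear bijection `u ↦ u ∘ h` between Lions–Magenes spaces. -/
noncomputable def equivLionsMagenes
    (P : IsBiLipschitzPair g h (frontier (Ω i)) (frontier (Ω' i)) L)
    (Q : IsBiLipschitzPair g h (interface Ω) (interface Ω') L') :
    LionsMagenes Ω i ≃ₗ[ℝ] LionsMagenes Ω' i where
  __ := P.symm.compLionsMagenes Q.symm
  invFun := P.compLionsMagenes Q
  left_inv u := LionsMagenes.toL2_injective (Q.compL2_symm_compL2 (LionsMagenes.toL2 u))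
  right_inv v := LionsMagenes.toL2_injective (Q.symm.compL2_symm_compL2 (LionsMagenes.toL2 v))

end IsBiLipschitzPair

/-! ### Evolving surfaces -/

/-- A compact surface `S 0` of finite measure, transported by a family of homeomorphisms `Φ t` of
`ℝⁿ` which are bi-Lipschitz on it with a constant independent of `t`. -/
structure IsEvolvingSurface {n : ℕ}
    (Φ Φinv : ℝ → EuclideanSpace ℝ (Fin n) → EuclideanSpace ℝ (Fin n))
    (S : ℝ≥0 → Set (EuclideanSpace ℝ (Fin n))) (L : ℝ≥0) : Prop where
  pair : ∀ t : ℝ≥0, IsBiLipschitzPair (Φ t) (Φinv t) (S 0) (S t) L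
  initial : ∀ x, Φ 0 x = x
  continuous_uncurry : Continuous fun p : ℝ≥0 × EuclideanSpace ℝ (Fin n) => Φ p.1 p.2
  isCompact : IsCompact (S 0)
  isFiniteMeasure_zero : IsFiniteMeasure (surfaceMeasure (S 0))

namespace IsEvolvingSurface

variable {n : ℕ} {Φ Φinv : ℝ → EuclideanSpace ℝ (Fin n) → EuclideanSpace ℝ (Fin n)}
  {S : ℝ≥0 → Set (EuclideanSpace ℝ (Fin n))} {L : ℝ≥0}

theorem image_eq (H : IsEvolvingSurface Φ Φinv S L) (t : ℝ≥0) : Φ t '' S 0 = S t :=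
  (H.pair t).mapsTo.image_subset.antisymm fun y hy =>
    ⟨Φinv t y, (H.pair t).mapsTo_inv hy, (H.pair t).right_inv y⟩

theorem measurableSet (H : IsEvolvingSurface Φ Φinv S L) (t : ℝ≥0) : MeasurableSet (S t) := by
  rw [← H.image_eq t]
  exact (H.isCompact.image (H.pair t).continuous).measurableSet

theorem measure_map_univ_le (H : IsEvolvingSurface Φ Φinv S L) (t : ℝ≥0) :
    (surfaceMeasure (S t)).map (Φinv t) univ ≤
      (L ^ (n - 1) : ℝ≥0) * surfaceMeasure (S 0) univ := by
  refine ((H.pair t).symm.map_surfaceMeasure_le univ).trans (le_of_eq ?_)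
  rw [Measure.smul_apply, ENNReal.smul_def, smul_eq_mul]

theorem isFiniteMeasure (H : IsEvolvingSurface Φ Φinv S L) (t : ℝ≥0) :
    IsFiniteMeasure (surfaceMeasure (S t)) := by
  have := H.isFiniteMeasure_zero
  have h := H.measure_map_univ_le t
  rw [Measure.map_apply (H.pair t).continuous_inv.measurable MeasurableSet.univ, preimage_univ] at h
  exact ⟨h.trans_lt (ENNReal.mul_lt_top ENNReal.coe_lt_top (measure_lt_top _ _))⟩

theorem measurable_map_surfaceMeasure (hn : 1 < n) (H : IsEvolvingSurface Φ Φinv S L) :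
    Measurable fun t : ℝ≥0 => (surfaceMeasure (S t)).map (Φinv t) := by
  have := H.isFiniteMeasure
  have hK : ∀ K : Set (EuclideanSpace ℝ (Fin n)), IsClosed K →
      Measurable fun t : ℝ≥0 => (surfaceMeasure (S t)).map (Φinv t) K := by
    intro K hK
    have heq : ∀ t : ℝ≥0, (surfaceMeasure (S t)).map (Φinv t) K =
        Measure.euclideanHausdorffMeasure (n - 1) (Φ t '' (K ∩ S 0)) := by
      intro t
      have hm := (H.pair t).continuous_inv.measurable
      rw [Measure.map_apply hm hK.measurableSet, surfaceMeasure,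
        Measure.restrict_apply (hm hK.measurableSet), image_inter (H.pair t).left_inv.injective,
        H.image_eq t, image_eq_preimage_of_inverse (H.pair t).left_inv (H.pair t).right_inv]
    simp only [heq]
    exact measurable_euclideanHausdorffMeasure_image (Nat.sub_pos_of_lt hn)
      (F := fun (t : ℝ≥0) x => Φ t x) H.continuous_uncurry (H.isCompact.inter_left hK)
  refine Measurable.measure_of_isPiSystem
    (BorelSpace.measurable_eq.trans borel_eq_generateFrom_isClosed) isPiSystem_isClosed
    (fun K hK' => hK K hK') (hK univ isClosed_univ)

/-- The surface measures on `S t`, pulled back to `S 0`, as a kernel in the variable `t`. -/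
noncomputable def kernel (hn : 1 < n) (H : IsEvolvingSurface Φ Φinv S L) :
    ProbabilityTheory.Kernel ℝ≥0 (EuclideanSpace ℝ (Fin n)) where
  toFun t := (surfaceMeasure (S t)).map (Φinv t)
  measurable' := H.measurable_map_surfaceMeasure hn

theorem kernel_apply (hn : 1 < n) (H : IsEvolvingSurface Φ Φinv S L) (t : ℝ≥0) :
    H.kernel hn t = (surfaceMeasure (S t)).map (Φinv t) := rfl

theorem isFiniteKernel (hn : 1 < n) (H : IsEvolvingSurface Φ Φinv S L) :
    ProbabilityTheory.IsFiniteKernel (H.kernel hn) :=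
  have := H.isFiniteMeasure_zero
  ⟨_, ENNReal.mul_lt_top ENNReal.coe_lt_top (measure_lt_top (surfaceMeasure (S 0)) univ),
    H.measure_map_univ_le⟩

/-! ### Measurability of the norms -/

theorem _root_.MeasureTheory.Lp.norm_sq_eq_integral {α : Type*} [MeasurableSpace α] {μ : Measure α}
    (u : Lp ℝ 2 μ) : ‖u‖ ^ 2 = ∫ x, u x ^ 2 ∂μ := by
  rw [← real_inner_self_eq_norm_sq u, L2.inner_def]
  refine integral_congr_ae (Filter.Eventually.of_forall fun x => ?_)
  simp [pow_two]

theorem norm_sq_equivL2 (hn : 1 < n) (H : IsEvolvingSurface Φ Φinv S L) (u : L2Surface (S 0))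
    (t : ℝ≥0) : ‖(H.pair t).equivL2 u‖ ^ 2 = ∫ x, u x ^ 2 ∂H.kernel hn t := by
  rw [Lp.norm_sq_eq_integral, kernel_apply,
    integral_map (H.pair t).continuous_inv.measurable.aemeasurable
      ((Lp.stronglyMeasurable u).measurable.pow_const 2).aestronglyMeasurable]
  refine integral_congr_ae ?_
  filter_upwards [(H.pair t).symm.coeFn_compL2 u] with x hx
  exact congrArg (· ^ 2) hx

theorem measurable_norm_equivL2 (hn : 1 < n) (H : IsEvolvingSurface Φ Φinv S L)
    (u : L2Surface (S 0)) : Measurable fun t => ‖(H.pair t).equivL2 u‖ := by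
  have := H.isFiniteKernel hn
  have h : Measurable fun t => ‖(H.pair t).equivL2 u‖ ^ 2 := by
    simp only [H.norm_sq_equivL2 hn]
    exact (StronglyMeasurable.integral_kernel_prod_right' (κ := H.kernel hn)
      (((Lp.stronglyMeasurable u).comp_measurable measurable_snd).pow 2)).measurable
  simpa only [Real.sqrt_sq (norm_nonneg _)] using h.sqrt

theorem norm_sq_quot_compHHalf (hn : 1 < n) (H : IsEvolvingSurface Φ Φinv S L)
    [∀ t, IsFiniteMeasure (surfaceMeasure (S t))]
    [ProbabilityTheory.IsFiniteKernel (H.kernel hn)] (u : HHalf (S 0)) (t : ℝ≥0) :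
    ‖HHalf.quot ((H.pair t).symm.compHHalf (H.measurableSet t) u)‖ ^ 2 =
      ∫ p, ((HHalf.toL2 u p.1 - HHalf.toL2 u p.2) /
        dist (Φ t p.1) (Φ t p.2) ^ ((n : ℝ) / 2)) ^ 2
          ∂(ProbabilityTheory.Kernel.prod (H.kernel hn) (H.kernel hn)) t := by
  have hm := (H.pair t).continuous_inv.measurable
  have hu := (Lp.stronglyMeasurable (HHalf.toL2 u)).measurable
  have hΦ := (H.pair t).continuous.measurable
  rw [Lp.norm_sq_eq_integral, ProbabilityTheory.Kernel.prod_apply, kernel_apply,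
    Measure.map_prod_map _ _ hm hm, integral_map (hm.prodMap hm).aemeasurable]
  · refine integral_congr_ae ?_
    filter_upwards [HHalf.coeFn_quot ((H.pair t).symm.compHHalf (H.measurableSet t) u),
      diffQuot_congr ((H.pair t).symm.coeFn_compL2 (HHalf.toL2 u))] with p h1 h2
    rw [h1, IsBiLipschitzPair.toL2_compHHalf, h2]
    simp only [diffQuot, Function.comp_apply, Prod.map_fst, Prod.map_snd, (H.pair t).right_inv _]
  · exact ((((hu.comp measurable_fst).sub (hu.comp measurable_snd)).div
      (((hΦ.comp measurable_fst).dist (hΦ.comp measurable_snd)).pow_const _)).pow_const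
        2).aestronglyMeasurable

theorem measurable_norm_compHHalf (hn : 1 < n) (H : IsEvolvingSurface Φ Φinv S L)
    [∀ t, IsFiniteMeasure (surfaceMeasure (S t))] (u : HHalf (S 0)) :
    Measurable fun t => ‖(H.pair t).symm.compHHalf (H.measurableSet t) u‖ := by
  have := H.isFiniteKernel hn
  have h1 := H.measurable_norm_equivL2 hn (HHalf.toL2 u)
  have hu := (Lp.stronglyMeasurable (HHalf.toL2 u)).measurable
  have hΦ := H.continuous_uncurry.measurable
  have hΦ1 : Measurable fun q : ℝ≥0 × EuclideanSpace ℝ (Fin n) × EuclideanSpace ℝ (Fin n) =>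
      Φ q.1 q.2.1 := hΦ.comp (measurable_fst.prodMk measurable_snd.fst)
  have hΦ2 : Measurable fun q : ℝ≥0 × EuclideanSpace ℝ (Fin n) × EuclideanSpace ℝ (Fin n) =>
      Φ q.1 q.2.2 := hΦ.comp (measurable_fst.prodMk measurable_snd.snd)
  have h2 : Measurable fun t =>
      ‖HHalf.quot ((H.pair t).symm.compHHalf (H.measurableSet t) u)‖ ^ 2 := by
    simp only [H.norm_sq_quot_compHHalf hn]
    exact (StronglyMeasurable.integral_kernel_prod_right'
      (κ := ProbabilityTheory.Kernel.prod (H.kernel hn) (H.kernel hn))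
      (f := fun q : ℝ≥0 × EuclideanSpace ℝ (Fin n) × EuclideanSpace ℝ (Fin n) =>
        ((HHalf.toL2 u q.2.1 - HHalf.toL2 u q.2.2) /
          dist (Φ q.1 q.2.1) (Φ q.1 q.2.2) ^ ((n : ℝ) / 2)) ^ 2)
      ((((hu.comp measurable_snd.fst).sub (hu.comp measurable_snd.snd)).div
        ((hΦ1.dist hΦ2).pow_const _)).pow_const 2).stronglyMeasurable).measurable
  have h : Measurable fun t =>
      ‖(H.pair t).symm.compHHalf (H.measurableSet t) u‖ ^ 2 := by
    simp only [HHalf.norm_sq_eq_add]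
    exact (h1.pow_const 2).add h2
  simpa only [Real.sqrt_sq (norm_nonneg _)] using h.sqrt

/-! ### Compatibility -/

theorem inv_zero_eq_id (H : IsEvolvingSurface Φ Φinv S L) :
    Φinv (0 : ℝ≥0) = id := by
  funext x
  have h := (H.pair 0).right_inv x
  rw [NNReal.coe_zero, H.initial] at h
  simpa using h

theorem equivL2_zero (H : IsEvolvingSurface Φ Φinv S L) (u : L2Surface (S 0)) :
    (H.pair 0).equivL2 u = u := by
  refine Lp.ext (((H.pair 0).symm.coeFn_compL2 u).trans ?_)
  rw [H.inv_zero_eq_id]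
  rfl

theorem isPullbackCompatible_L2 (hn : 1 < n) (H : IsEvolvingSurface Φ Φinv S L) :
    IsPullbackCompatible Φ Φinv S (fun t => L2Surface (S t)) (fun _ => LinearMap.id) := by
  have := H.isFiniteMeasure
  refine ⟨fun t => (H.pair t).equivL2, fun t => ⟨fun u f hf => (H.pair t).symm.compL2_ae_eq hf,
    fun v f hf => (H.pair t).compL2_ae_eq hf⟩, fun t => inferInstance, fun t => ?_,
    H.equivL2_zero, ⟨l2Const n L, fun t => ⟨(H.pair t).symm.norm_compL2_le,
      (H.pair t).norm_compL2_le⟩⟩, H.measurable_norm_equivL2 hn⟩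
  have := L2Surface.secondCountableTopology (S t)
  infer_instance

theorem isPullbackCompatible_HHalf (hn : 1 < n) (H : IsEvolvingSurface Φ Φinv S L) :
    IsPullbackCompatible Φ Φinv S (fun t => HHalf (S t)) (fun _ => HHalf.toL2) := by
  have := H.isFiniteMeasure
  refine ⟨fun t => (H.pair t).equivHHalf (H.measurableSet 0) (H.measurableSet t),
    fun t => ⟨fun u f hf => (H.pair t).symm.compL2_ae_eq hf,
      fun v f hf => (H.pair t).compL2_ae_eq hf⟩, fun t => inferInstance, fun t => ?_,
    fun u => HHalf.toL2_injective (H.equivL2_zero _), ⟨l2Const n L + quotConst n L, fun t =>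
      ⟨(H.pair t).symm.norm_compHHalf_le (H.measurableSet t),
        (H.pair t).norm_compHHalf_le (H.measurableSet 0)⟩⟩, H.measurable_norm_compHHalf hn⟩
  have := HHalf.secondCountableTopology (S := S t)
  infer_instance

theorem isPullbackCompatible_lionsMagenes (hn : 1 < n)
    {Ω : ℝ≥0 → Fin 2 → Set (EuclideanSpace ℝ (Fin n))} {i : Fin 2} {L' : ℝ≥0}
    (H : IsEvolvingSurface Φ Φinv (fun t => frontier (Ω t i)) L)
    (H' : IsEvolvingSurface Φ Φinv (fun t => interface (Ω t)) L') :
    IsPullbackCompatible Φ Φinv (fun t => interface (Ω t)) (fun t => LionsMagenes (Ω t) i)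
      (fun _ => LionsMagenes.toL2) := by
  have := H.isFiniteMeasure
  have hbound : ∀ t : ℝ≥0, ∀ u : LionsMagenes (Ω 0) i,
      LionsMagenes.extend ((H.pair t).symm.compLionsMagenes (H'.pair t).symm u) =
        (H.pair t).symm.compHHalf (H.measurableSet t) (LionsMagenes.extend u) :=
    fun t u => (H.pair t).symm.extend_compLionsMagenes (H'.pair t).symm u
  refine ⟨fun t => (H.pair t).equivLionsMagenes (H'.pair t),
    fun t => ⟨fun u f hf => (H'.pair t).symm.compL2_ae_eq hf,
      fun v f hf => (H'.pair t).compL2_ae_eq hf⟩, fun t => inferInstance, fun t => ?_,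
    fun u => LionsMagenes.toL2_injective (H'.equivL2_zero _),
    ⟨l2Const n L + quotConst n L, fun t => ⟨fun u => ?_, fun v => ?_⟩⟩, fun u => ?_⟩
  · have := LionsMagenes.secondCountableTopology (Ω := Ω t) (i := i)
    infer_instance
  · change ‖LionsMagenes.extend ((H.pair t).symm.compLionsMagenes (H'.pair t).symm u)‖ ≤
      _ * ‖LionsMagenes.extend u‖
    rw [hbound]
    exact (H.pair t).symm.norm_compHHalf_le (H.measurableSet t) _
  · change ‖LionsMagenes.extend ((H.pair t).compLionsMagenes (H'.pair t) v)‖ ≤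
      _ * ‖LionsMagenes.extend v‖
    rw [(H.pair t).extend_compLionsMagenes (H'.pair t)]
    exact (H.pair t).norm_compHHalf_le (H.measurableSet 0) _
  · change Measurable fun t : ℝ≥0 =>
      ‖LionsMagenes.extend ((H.pair t).symm.compLionsMagenes (H'.pair t).symm u)‖
    simp only [hbound]
    exact H.measurable_norm_compHHalf hn (LionsMagenes.extend u)

end IsEvolvingSurface

/-! ### The flow -/

namespace IsUniformlyC1

variable {n : ℕ} {F : ℝ → EuclideanSpace ℝ (Fin n) → EuclideanSpace ℝ (Fin n)}

theorem contDiff (hF : IsUniformlyC1 F) {t : ℝ} (ht : 0 ≤ t) : ContDiff ℝ 1 (F t) := by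
  rw [← contDiffOn_univ]
  exact hF.contDiffOn.comp (contDiff_prodMk_right t).contDiffOn fun x _ => ⟨ht, mem_univ x⟩

theorem continuous_uncurry (hF : IsUniformlyC1 F) :
    Continuous fun p : ℝ≥0 × EuclideanSpace ℝ (Fin n) => F p.1 p.2 :=
  hF.contDiffOn.continuousOn.comp_continuous
    (f := fun p : ℝ≥0 × EuclideanSpace ℝ (Fin n) => ((p.1 : ℝ), p.2)) (by fun_prop)
    fun p => ⟨p.1.2, mem_univ p.2⟩

theorem exists_bound_lipschitzOnWith (hF : IsUniformlyC1 F) (h0 : ∀ x, F 0 x = x) {r : ℝ}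
    (hr : 0 < r) : ∃ K : ℝ≥0, ∀ t : ℝ, 0 ≤ t →
      MapsTo (F t) (Metric.closedBall 0 r) (Metric.closedBall 0 K) ∧
        LipschitzOnWith K (F t) (Metric.closedBall 0 r) := by
  obtain ⟨C, hC⟩ := hF.bound r hr
  refine ⟨C.toNNReal + r.toNNReal + 1, fun t ht => ?_⟩
  rcases ht.eq_or_lt with rfl | ht'
  · have hid : F 0 = id := funext h0
    rw [hid]
    refine ⟨fun x hx => Metric.closedBall_subset_closedBall ?_ hx,
      LipschitzWith.id.lipschitzOnWith.weaken le_add_self⟩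
    push_cast
    linarith [Real.le_coe_toNNReal r, C.toNNReal.coe_nonneg]
  · have hle : C ≤ (C.toNNReal + r.toNNReal + 1 : ℝ≥0) := by
      push_cast
      linarith [Real.le_coe_toNNReal C, r.toNNReal.coe_nonneg]
    refine ⟨fun x hx => mem_closedBall_zero_iff.2 (((hC t ht' x hx).1).trans hle), ?_⟩
    refine (convex_closedBall _ _).lipschitzOnWith_of_nnnorm_fderiv_le
      (fun x _ => ((hF.contDiff ht).differentiable one_ne_zero).differentiableAt) fun x hx => ?_
    exact NNReal.coe_le_coe.1 (((hC t ht' x hx).2).trans hle)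

end IsUniformlyC1

namespace IsC1Flow

variable {n : ℕ} {w Φ Φinv : ℝ → EuclideanSpace ℝ (Fin n) → EuclideanSpace ℝ (Fin n)}

theorem initial_inv (hΦ : IsC1Flow w Φ Φinv) (x : EuclideanSpace ℝ (Fin n)) : Φinv 0 x = x := by
  simpa only [hΦ.initial] using hΦ.right_inv 0 le_rfl x

theorem exists_isEvolvingSurface (hΦ : IsC1Flow w Φ Φinv)
    {S : ℝ≥0 → Set (EuclideanSpace ℝ (Fin n))} (hS : ∀ t : ℝ≥0, S t = Φ t '' S 0)
    (hc : IsCompact (S 0)) (hfin : Measure.euclideanHausdorffMeasure (n - 1) (S 0) < ∞) :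
    ∃ L, IsEvolvingSurface Φ Φinv S L := by
  obtain ⟨r, hr, hSr⟩ := hc.isBounded.subset_closedBall_lt 0 0
  obtain ⟨K, hK⟩ := hΦ.smooth.exists_bound_lipschitzOnWith hΦ.initial hr
  obtain ⟨K', hK'⟩ := hΦ.smooth_inv.exists_bound_lipschitzOnWith hΦ.initial_inv
    (r := K + 1) (by positivity)
  refine ⟨max K K', fun t => ?_, hΦ.initial, hΦ.smooth.continuous_uncurry, hc,
    ⟨by rwa [surfaceMeasure, Measure.restrict_apply_univ]⟩⟩
  refine ⟨(hΦ.smooth.contDiff t.2).continuous, (hΦ.smooth_inv.contDiff t.2).continuous,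
    hΦ.left_inv t t.2, hΦ.right_inv t t.2, ?_, ?_,
    ((hK t t.2).2.mono hSr).weaken (le_max_left _ _),
    ((hK' t t.2).2.mono ?_).weaken (le_max_right _ _)⟩
  · rw [hS t]
    exact mapsTo_image _ _
  · rw [hS t]
    rintro _ ⟨x, hx, rfl⟩
    rwa [hΦ.left_inv t t.2 x]
  · rw [hS t]
    rintro _ ⟨x, hx, rfl⟩
    exact Metric.closedBall_subset_closedBall (by linarith) ((hK t t.2).1 (hSr hx))

theorem frontier_image (hΦ : IsC1Flow w Φ Φinv) (t : ℝ≥0) (A : Set (EuclideanSpace ℝ (Fin n))) :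
    frontier (Φ t '' A) = Φ t '' frontier A :=
  (Homeomorph.image_frontier
    { toFun := Φ t
      invFun := Φinv t
      left_inv := hΦ.left_inv t t.2
      right_inv := hΦ.right_inv t t.2
      continuous_toFun := (hΦ.smooth.contDiff t.2).continuous
      continuous_invFun := (hΦ.smooth_inv.contDiff t.2).continuous } A).symm

theorem image_zero (hΦ : IsC1Flow w Φ Φinv) (A : Set (EuclideanSpace ℝ (Fin n))) :
    Φ (0 : ℝ≥0) '' A = A := by
  rw [NNReal.coe_zero, show Φ 0 = id from funext hΦ.initial, image_id]

theorem interface_image (hΦ : IsC1Flow w Φ Φinv) (t : ℝ≥0)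
    (Ω : Fin 2 → Set (EuclideanSpace ℝ (Fin n))) :
    interface (fun i => Φ t '' Ω i) = Φ t '' interface Ω := by
  simp only [interface, hΦ.frontier_image, image_inter (hΦ.left_inv t t.2).injective]

theorem exists_isEvolvingSurface_frontier (hΦ : IsC1Flow w Φ Φinv)
    {Ω : Set (EuclideanSpace ℝ (Fin n))} (hΩ : IsBoundedLipschitzDomain Ω) :
    ∃ L, IsEvolvingSurface Φ Φinv (fun t : ℝ≥0 => frontier (Φ t '' Ω)) L := by
  refine hΦ.exists_isEvolvingSurface (fun t => ?_) ?_ ?_ <;> simp only [hΦ.image_zero]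
  · exact hΦ.frontier_image t Ω
  · exact hΩ.isCompact_frontier
  · exact hΩ.euclideanHausdorffMeasure_frontier_lt_top

theorem exists_isEvolvingSurface_interface (hΦ : IsC1Flow w Φ Φinv)
    {Ω : Fin 2 → Set (EuclideanSpace ℝ (Fin n))} (hΩ : ∀ i, IsBoundedLipschitzDomain (Ω i)) :
    ∃ L, IsEvolvingSurface Φ Φinv (fun t : ℝ≥0 => interface fun i => Φ t '' Ω i) L := by
  refine hΦ.exists_isEvolvingSurface (fun t => ?_) ?_ ?_ <;> simp only [hΦ.image_zero]
  · exact hΦ.interface_image t Ω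
  · exact (hΩ 0).isCompact_frontier.inter_right isClosed_frontier
  · exact (measure_mono (interface_subset Ω 0)).trans_lt
      (hΩ 0).euclideanHausdorffMeasure_frontier_lt_top

end IsC1Flow

theorem mainTheorem8 {n : ℕ} (hn : n = 2 ∨ n = 3)
    (Ω : Set (EuclideanSpace ℝ (Fin n))) (Ωsub : Fin 2 → Set (EuclideanSpace ℝ (Fin n)))
    (hΩ : IsBoundedLipschitzDomain Ω) (hΩsub : ∀ i, IsBoundedLipschitzDomain (Ωsub i))
    (hdisj : Disjoint (Ωsub 0) (Ωsub 1))
    (hcover : closure Ω = closure (Ωsub 0) ∪ closure (Ωsub 1))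
    (w Φ Φinv : ℝ → EuclideanSpace ℝ (Fin n) → EuclideanSpace ℝ (Fin n))
    (hΦ : IsC1Flow w Φ Φinv) :
    (∀ S : ℝ≥0 → Set (EuclideanSpace ℝ (Fin n)),
      ((S = fun t : ℝ≥0 => frontier (Φ t '' Ω)) ∨
        (∃ i, S = fun t : ℝ≥0 => frontier (Φ t '' Ωsub i)) ∨
        (S = fun t : ℝ≥0 => interface fun i => Φ t '' Ωsub i)) →
      IsPullbackCompatible Φ Φinv S (fun t => L2Surface (S t)) (fun _ => LinearMap.id) ∧
      IsPullbackCompatible Φ Φinv S (fun t => HHalf (S t)) (fun _ => HHalf.toL2)) ∧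
    (∀ i : Fin 2,
      IsPullbackCompatible Φ Φinv (fun t : ℝ≥0 => interface fun j => Φ t '' Ωsub j)
        (fun t : ℝ≥0 => LionsMagenes (fun j => Φ t '' Ωsub j) i) (fun _ => LionsMagenes.toL2)) := by
  have hn' : 1 < n := by omega
  obtain ⟨L', H'⟩ := hΦ.exists_isEvolvingSurface_interface hΩsub
  refine ⟨?_, fun i => ?_⟩
  · rintro S (rfl | ⟨i, rfl⟩ | rfl)
    · obtain ⟨L, H⟩ := hΦ.exists_isEvolvingSurface_frontier hΩ
      exact ⟨H.isPullbackCompatible_L2 hn', H.isPullbackCompatible_HHalf hn'⟩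
    · obtain ⟨L, H⟩ := hΦ.exists_isEvolvingSurface_frontier (hΩsub i)
      exact ⟨H.isPullbackCompatible_L2 hn', H.isPullbackCompatible_HHalf hn'⟩
    · exact ⟨H'.isPullbackCompatible_L2 hn', H'.isPullbackCompatible_HHalf hn'⟩
  · obtain ⟨L, H⟩ := hΦ.exists_isEvolvingSurface_frontier (hΩsub i)
    exact IsEvolvingSurface.isPullbackCompatible_lionsMagenes hn'
      (Ω := fun t j => Φ t '' Ωsub j) H H'
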